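/- **Model.** Fix $\lambda_B,\lambda_u,A_B,P_B,P_d,\beta,P_0,T>0$, $\alpha_B>2$, $\sigma_B\ge 0$, $\varepsilon\in(0,1]$, $\eta\ge 0$. Every link between a user and a base station (BS) of length $R$ carries a fading $\mathcal H=e^{\xi}$ with $\xi\sim N(0,\sigma_B^2)$ and has gain $A_B\mathcal H R^{-\alpha_B}$; its *equivalent distance* is $\overline R=\mathcal H^{-1/\alpha_B}R$. Write $t=\left(\frac{\beta}{A_BP_B}\right)^{-1/\alpha_B}$. *Typical user.* BSs form a homogeneous Poisson point process (PPP) of intensity $\lambda_B$ in $\mathbb R^2$ with i.i.d. fadings towards a typical user at the origin. The user is served by the BS from which it receives the largest power $P^*=\max_b P_BA_B\mathcal H_bR_b^{-\alpha_B}$. It is in cellular mode if $P^*>\beta$, and in D2D mode otherwise; $q=\Pr[P^*>\beta]$. Let $\nu$ be the conditional law of (length, fading) of the serving link given $P^*>\beta$. A cellular user with serving link $(R,\mathcal H)$ transmits with power $P_0\left(\frac{R^{\alpha_B}}{\mathcal H A_B}\right)^{\varepsilon}$. *Typical BS at the origin.* The following three are independent. 1. The link $(R_{B,0},\mathcal H_{B,0})\sim\nu$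 to its own user. 2. The active cellular users of the other cells: a homogeneous PPP of intensity $\lambda_B$ with independent marks, namely the fading towards the typical BS and the user's own serving link (with law $\nu$, determining its transmit power). 3. The D2D users: a homogeneous PPP of intensity $(1-q)\lambda_u$ with independent marks, namely the fading towards the typical BS and a fair coin deciding whether the user is a transmitter; D2D transmitters use the constant power $P_d$. A point of 2 or 3 interferes only if the power it receives from the typical BS (through the same link) is at most $\beta$, i.e. if its equivalent distance to the typical BS is at least $t$. The SINR is the received power of the own user divided by the sum of the received interference powers of the cellular users and the D2D transmitters and of the noise power $\eta$. **Claim.** The equivalent serving distance $\overline{R_{B,0}}=\mathcal H_{B,0}^{-1/\alpha_B}R_{B,0}$ has on $(0,t]$ the probability density $$f(r)=\frac{2\pi\lambda_B r\exp\left(-\pi\lambda_Br^2e^{2\sigma_B^2/\alpha_B^2}+\frac{2\sigma_B^2}{\alpha_B^2}\right)}{1-\exp\left(-\pi\lambda_B\left(\frac{A_BP_B}{\beta}\right)^{2/\alpha_B}e^{2\sigma_B^2/\alpha_B^2}\right)},$$ and $$\Pr[\mathrm{SINR}>T]=\int_0^t\left(\int_{-\infty}^{\infty}\frac{e^{i\omega/T}-1}{2\pi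 i\omega}\,\mathcal F(r_0,\omega)\,d\omega\right)f(r_0)\,dr_0,$$ where both integrals converge absolutely. Here $\mathcal F(r_0,\omega)=\mathbb E\left[e^{-i\omega/\mathrm{SINR}}\,\middle|\,\overline{R_{B,0}}=r_0\right]$ is the conditional characteristic function of $1/\mathrm{SINR}$ (which is almost surely finite), and it is given, with absolutely convergent integrals over $(t,\infty)$, by $$\begin{aligned}\mathcal F(r_0,\omega)={}&\exp\left\{-2\pi\lambda_Be^{\frac{2\sigma_B^2}{\alpha_B^2}}\int_t^\infty\left(1-\int_0^t\exp\left(-\frac{i\omega}{r_0^{\alpha_B(\varepsilon-1)}}\,r^{\alpha_B\varepsilon}\tau^{-\alpha_B}\right)f(r)\,dr\right)\tau\,d\tau\right\}\\ &\times\exp\left\{-\pi(1-q)\lambda_ue^{\frac{2\sigma_B^2}{\alpha_B^2}}\int_t^\infty\left(1-\exp\left(-\frac{i\omega A_B^{\varepsilon}P_d}{P_0\,r_0^{\alpha_B(\varepsilon-1)}}\,L^{-\alpha_B}\right)\right)L\,dL\right\}\\ &\times\exp\left(-\frac{i\omega\eta}{\frac{P_0}{A_B^{\varepsilon-1}}\,r_0^{\alpha_B(\varepsilon-1)}}\right).\end{aligned}$$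 -/

import Mathlib

open MeasureTheory ProbabilityTheory Set
open scoped ENNReal

/-! ### Poisson point processes -/

/-- The number of points of the enumerated random configuration `{X 0, X 1, …}` (with
multiplicity) that lie in `B`. -/
noncomputable def pointCount {Ω E : Type*} (X : ℕ → Ω → E) (B : Set E) (ω : Ω) : ℝ≥0∞ :=
  Measure.count {n : ℕ | X n ω ∈ B}

/-- `{X 0, X 1, …}` is a Poisson point process on `E` with intensity measure `Λ`: counts in sets of
finite intensity are Poisson, counts in pairwise disjoint sets are independent.
If `E` is a product and `Λ` a product measure with a probability factor, this is an
independently marked Poisson process. -/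
structure IsPoissonProcess {Ω E : Type*} [MeasurableSpace Ω] [MeasurableSpace E]
    (X : ℕ → Ω → E) (Λ : Measure E) (P : Measure Ω) : Prop where
  measurable : ∀ n, Measurable (X n)
  law_count : ∀ B : Set E, MeasurableSet B → Λ B ≠ ∞ →
    HasLaw (pointCount X B) ((poissonMeasure (Λ B).toNNReal).map (Nat.cast : ℕ → ℝ≥0∞)) P
  indep_count : ∀ (k : ℕ) (B : Fin k → Set E), (∀ j, MeasurableSet (B j)) →
    Pairwise (fun i j => Disjoint (B i) (B j)) → iIndepFun (fun j => pointCount X (B j)) P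

/-! ### Network parameters, path loss, fading, power control -/

/-- The Euclidean plane. -/
abbrev Plane : Type := EuclideanSpace ℝ (Fin 2)

/-- Parameters of the network. -/
structure Network where
  /-- base station intensity -/
  lamB : ℝ
  /-- user intensity -/
  lamU : ℝ
  /-- path loss exponent of links between users and base stations -/
  α : ℝ
  /-- path loss constant of these links (linear scale) -/
  A : ℝ
  /-- standard deviation of the logarithm of the lognormal fading of these links -/
  σ : ℝ
  /-- transmit power of a base station -/
  PB : ℝ
  /-- transmit power of a D2D transmitter -/
  Pd : ℝ
  /-- mode selection threshold -/
  β : ℝ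
  /-- receiver sensitivity in the power control rule -/
  P0 : ℝ
  /-- fractional path loss compensation -/
  ε : ℝ
  /-- noise power at a base station -/
  η : ℝ
  lamB_pos : 0 < lamB
  lamU_pos : 0 < lamU
  two_lt_α : 2 < α
  A_pos : 0 < A
  σ_nonneg : 0 ≤ σ
  PB_pos : 0 < PB
  Pd_pos : 0 < Pd
  β_pos : 0 < β
  P0_pos : 0 < P0
  ε_pos : 0 < ε
  ε_le_one : ε ≤ 1
  η_nonneg : 0 ≤ η

namespace Network

variable (N : Network)

/-- Law of the lognormal fading coefficient `exp ξ`, `ξ ∼ N(0, σ²)`. -/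
noncomputable def fadingLaw : Measure ℝ :=
  (gaussianReal 0 (Real.toNNReal (N.σ ^ 2))).map Real.exp

/-- Gain of a link of length `R` with fading `h`. -/
noncomputable def gain (R h : ℝ) : ℝ := N.A * h * R ^ (-N.α)

/-- Power received over a link of length `R` with fading `h` from a base station. -/
noncomputable def downlinkPower (R h : ℝ) : ℝ := N.PB * N.gain R h

/-- Transmit power of a cellular user whose serving link has length `R` and fading `h`
(fractional channel inversion). -/
noncomputable def uplinkTxPower (R h : ℝ) : ℝ := N.P0 * (R ^ N.α / (h * N.A)) ^ N.ε

/-- Equivalent distance of a link of length `R` with fading `h`. -/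
noncomputable def equivDist (R h : ℝ) : ℝ := h ^ (-1 / N.α) * R

/-! ### A typical user at the origin: mode and serving link -/

/-- Intensity of the process of base stations `x`, each marked with its fading coefficient
towards the typical user. -/
noncomputable def bsIntensity : Measure (Plane × ℝ) :=
  ENNReal.ofReal N.lamB • (volume : Measure Plane).prod N.fadingLaw

/-- Index of the strongest base station in a configuration of (location, fading) pairs. -/
noncomputable def servingIndex (x : ℕ → Plane × ℝ) : ℕ :=
  sInf {n | ∀ m, N.downlinkPower ‖(x m).1‖ (x m).2 ≤ N.downlinkPower ‖(x n).1‖ (x n).2}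

/-- Length and fading of the link to the strongest base station. -/
noncomputable def servingLink (x : ℕ → Plane × ℝ) : ℝ × ℝ :=
  (‖(x (N.servingIndex x)).1‖, (x (N.servingIndex x)).2)

/-- The event that the typical user operates in cellular mode: the largest power received from
a base station exceeds `β`. -/
def cellularEvent {Ω : Type*} (Φb : ℕ → Ω → Plane × ℝ) : Set Ω :=
  {ω | ENNReal.ofReal N.β <
    ⨆ n, ENNReal.ofReal (N.downlinkPower ‖(Φb n ω).1‖ (Φb n ω).2)}

/-- The probability `q` that the typical user operates in cellular mode. -/
noncomputable def cellularProb {Ω : Type*} [MeasurableSpace Ω] (Φb : ℕ → Ω → Plane × ℝ)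
    (P : Measure Ω) : ℝ :=
  P.real (N.cellularEvent Φb)

/-- The law of (length, fading) of the serving link of a cellular user: the conditional law for
the typical user given that it operates in cellular mode. -/
noncomputable def servingLaw {Ω : Type*} [MeasurableSpace Ω] (Φb : ℕ → Ω → Plane × ℝ)
    (P : Measure Ω) : Measure (ℝ × ℝ) :=
  (ProbabilityTheory.cond P (N.cellularEvent Φb)).map (fun ω => N.servingLink (fun n => Φb n ω))

/-! ### A typical base station at the origin: interference and SINR -/

/-- Intensity of the active cellular users of the other cells: location, fading towards the typical
base station, and (length, fading) of the user's own serving link, distributed as `ν`. -/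
noncomputable def cuIntensity (ν : Measure (ℝ × ℝ)) : Measure ((Plane × ℝ) × (ℝ × ℝ)) :=
  (ENNReal.ofReal N.lamB • (volume : Measure Plane).prod N.fadingLaw).prod ν

/-- Intensity of the D2D users, `q` being the probability of cellular mode: location, fading towards
the typical base station, and a fair coin deciding whether the user transmits (`true`) or
receives (`false`). -/
noncomputable def d2dIntensity (q : ℝ) : Measure ((Plane × ℝ) × Bool) :=
  (ENNReal.ofReal ((1 - q) * N.lamU) • (volume : Measure Plane).prod N.fadingLaw).prod
    (uniformOn (univ : Set Bool))

/-- The random elements seen from the typical base station: its own serving link `L₀`, the active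
cellular users `Φc` of the other cells, and the D2D users `Φd`; they are independent. -/
structure IsUplinkModel {Ω : Type*} [MeasurableSpace Ω] (ν : Measure (ℝ × ℝ)) (q : ℝ)
    (L₀ : Ω → ℝ × ℝ) (Φc : ℕ → Ω → (Plane × ℝ) × (ℝ × ℝ)) (Φd : ℕ → Ω → (Plane × ℝ) × Bool)
    (P : Measure Ω) : Prop where
  measurable_link : Measurable L₀
  law_link : P.map L₀ = ν
  poisson_cu : IsPoissonProcess Φc (N.cuIntensity ν) P
  poisson_d2d : IsPoissonProcess Φd (N.d2dIntensity q) P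
  indep_cu_d2d : IndepFun (fun ω n => Φc n ω) (fun ω n => Φd n ω) P
  indep_link : IndepFun L₀ (fun ω => ((fun n => Φc n ω), (fun n => Φd n ω))) P

/-- Power received by the typical base station from its own user. -/
noncomputable def signal (l : ℝ × ℝ) : ℝ :=
  N.uplinkTxPower l.1 l.2 * N.gain l.1 l.2

/-- Interference from one cellular user. The users that receive more than `β` from the typical base
station are in its own cell and do not interfere. -/
noncomputable def cuInterference (p : (Plane × ℝ) × (ℝ × ℝ)) : ℝ :=
  if N.downlinkPower ‖p.1.1‖ p.1.2 ≤ N.β then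
    N.uplinkTxPower p.2.1 p.2.2 * N.gain ‖p.1.1‖ p.1.2 else 0

/-- Interference from one D2D user: it must be a transmitter, and, being in D2D mode, it receives
at most `β` from the typical base station. -/
noncomputable def d2dInterference (p : (Plane × ℝ) × Bool) : ℝ :=
  if p.2 = true ∧ N.downlinkPower ‖p.1.1‖ p.1.2 ≤ N.β then
    N.Pd * N.gain ‖p.1.1‖ p.1.2 else 0

/-- The SINR at the typical base station, as an extended nonnegative number. -/
noncomputable def sinr {Ω : Type*} (L₀ : Ω → ℝ × ℝ) (Φc : ℕ → Ω → (Plane × ℝ) × (ℝ × ℝ))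
    (Φd : ℕ → Ω → (Plane × ℝ) × Bool) (ω : Ω) : ℝ≥0∞ :=
  ENNReal.ofReal (N.signal (L₀ ω)) /
    ((∑' n, ENNReal.ofReal (N.cuInterference (Φc n ω))) +
      (∑' n, ENNReal.ofReal (N.d2dInterference (Φd n ω))) + ENNReal.ofReal N.η)

/-- Equivalent distance between the typical base station and its own user. -/
noncomputable def servingEquivDist {Ω : Type*} (L₀ : Ω → ℝ × ℝ) (ω : Ω) : ℝ :=
  N.equivDist (L₀ ω).1 (L₀ ω).2

/-! ### The closed-form expressions -/

/-- `t = (β / (A P_B)) ^ (-1/α)`. -/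
noncomputable def cellRadius : ℝ := (N.β / (N.A * N.PB)) ^ (-1 / N.α)

/-- The probability density on `(0, t]` of the equivalent serving distance. -/
noncomputable def servingPdf (r : ℝ) : ℝ :=
  2 * Real.pi * N.lamB * r *
      Real.exp (-Real.pi * N.lamB * r ^ 2 * Real.exp (2 * N.σ ^ 2 / N.α ^ 2)
        + 2 * N.σ ^ 2 / N.α ^ 2) /
    (1 - Real.exp (-Real.pi * N.lamB * (N.A * N.PB / N.β) ^ (2 / N.α)
      * Real.exp (2 * N.σ ^ 2 / N.α ^ 2)))

/-- Radial integrand for the cellular interferers, at serving distance `r₀` and frequency `w`. -/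
noncomputable def cuIntegrand (r₀ w τ : ℝ) : ℂ :=
  (1 - ∫ r in (0 : ℝ)..N.cellRadius,
      Complex.exp (-(Complex.I * w / (r₀ ^ (N.α * (N.ε - 1)) : ℝ)
        * (r ^ (N.α * N.ε) : ℝ) * (τ ^ (-N.α) : ℝ))) * (N.servingPdf r : ℂ)) * τ

/-- Radial integrand for the D2D interferers. -/
noncomputable def d2dIntegrand (r₀ w l : ℝ) : ℂ :=
  (1 - Complex.exp (-(Complex.I * w * (N.A ^ N.ε * N.Pd : ℝ)
      / (N.P0 * r₀ ^ (N.α * (N.ε - 1)) : ℝ) * (l ^ (-N.α) : ℝ)))) * l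

/-- The claimed conditional characteristic function of `1 / SINR` at frequency `w` given the
equivalent serving distance `r₀`. -/
noncomputable def condCharFun (q r₀ w : ℝ) : ℂ :=
  Complex.exp (-((2 * Real.pi * N.lamB * Real.exp (2 * N.σ ^ 2 / N.α ^ 2) : ℝ) : ℂ)
      * ∫ τ in Ioi N.cellRadius, N.cuIntegrand r₀ w τ)
  * Complex.exp (-((Real.pi * (1 - q) * N.lamU * Real.exp (2 * N.σ ^ 2 / N.α ^ 2) : ℝ) : ℂ)
      * ∫ l in Ioi N.cellRadius, N.d2dIntegrand r₀ w l)
  * Complex.exp (-(Complex.I * w * N.η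
      / (N.P0 / N.A ^ (N.ε - 1) * r₀ ^ (N.α * (N.ε - 1)) : ℝ)))

end Network

/-- The inversion kernel `(e^{iw/T} - 1) / (2π i w)`. -/
noncomputable def inversionKernel (T w : ℝ) : ℂ :=
  (Complex.exp (Complex.I * w / T) - 1) / (2 * Real.pi * Complex.I * w)

/-! Lognormal fading can be absorbed into distance. At fixed fading `h`, the points of the plane
with equivalent distance at most `r` form a disc of area `π h^(2/α) r²`; averaging over `h` replaces
`h^(2/α)` by its mean `exp (2σ²/α²)`. Seen through equivalent distances, every user and base station
process is therefore Poisson with a radial intensity scaled by this one constant (`map_equivDist`).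
Almost surely, gains, powers, mode and serving station depend on equivalent distances alone. The
void probability of a disc gives a Rayleigh law for the nearest equivalent distance; cellular mode
means that it is below `t`, and truncating the Rayleigh law gives the density `servingPdf`
(`map_servingLaw`).

Given the serving distance `r₀`, the received signal is the constant `signalAt r₀`, while
interference plus noise is independent of the own link. Hence conditioning amounts to freezing `r₀`
(`condExp_comp_ae_eq_of_indepFun`), and the characteristic functional of a Poisson process
(`IsPoissonProcess.integral_exp_tsum`) evaluates the two interference sums. They are almost surely
finite, because interferers stay beyond `t` and `α > 2`. This identifies `condCharFun`.

Coverage is the event that `1 / SINR` lies below `1 / T`. The inversion formula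
`measureReal_Iio_eq_integral_inversionKernel` applies once the characteristic function is integrable
in `w`. The D2D factor ensures this: `q < 1` leaves a positive intensity of transmitters of constant
power, and the real part of its exponent grows like `|w|^(2/α)` (`norm_condCharFun_le`). Integrating
over the law of `r₀` then gives the unconditional probability. -/

open Filter Topology

/-! ### Poisson processes: mean measure, Campbell's formula, characteristic functional. -/

section PoissonProcess

lemma lintegral_natCast_poissonMeasure (r : NNReal) :
    ∫⁻ n, (n : ℝ≥0∞) ∂(poissonMeasure r) = r := by
  have key : ∀ n : ℕ, ENNReal.ofReal (Real.exp (-r) * (r : ℝ) ^ (n + 1) / (n + 1).factorial) *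
      ((n + 1 : ℕ) : ℝ≥0∞)
      = r * ENNReal.ofReal (Real.exp (-r) * (r : ℝ) ^ n / n.factorial) := by
    intro n
    rw [← ENNReal.ofReal_natCast, ← ENNReal.ofReal_mul (by positivity),
      show (r : ℝ≥0∞) = ENNReal.ofReal r by simp, ← ENNReal.ofReal_mul (by positivity)]
    congr 1
    rw [Nat.factorial_succ]
    push_cast
    field_simp
    ring
  have hone : ∑' n : ℕ, ENNReal.ofReal (Real.exp (-r) * (r : ℝ) ^ n / n.factorial) = 1 := by
    rw [← ENNReal.ofReal_tsum_of_nonneg (fun n => by positivity)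
      (hasSum_one_poissonMeasure r).summable, (hasSum_one_poissonMeasure r).tsum_eq]
    simp
  rw [poissonMeasure, lintegral_sum_measure]
  simp only [lintegral_smul_measure, lintegral_dirac, smul_eq_mul]
  rw [tsum_eq_zero_add' ENNReal.summable]
  simp_rw [key, ENNReal.tsum_mul_left, hone]
  simp

variable {Ω E : Type*} {X : ℕ → Ω → E}

lemma pointCount_eq_tsum (X : ℕ → Ω → E) (B : Set E) (ω : Ω) :
    pointCount X B ω = ∑' n, B.indicator (fun _ => (1 : ℝ≥0∞)) (X n ω) := by
  rw [pointCount, Measure.count, Measure.sum_apply _ (Set.to_countable _).measurableSet]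
  congr 1
  ext n
  rw [Measure.dirac_apply' _ (Set.to_countable _).measurableSet]
  rfl

lemma finite_of_pointCount_ne_top {B : Set E} {ω : Ω} (h : pointCount X B ω ≠ ∞) :
    {n | X n ω ∈ B}.Finite := by
  rw [pointCount] at h
  exact Measure.count_apply_lt_top.1 (lt_top_iff_ne_top.2 h)

lemma hasSum_indicator_of_pointCount_ne_top {B : Set E} {ω : Ω} (h : pointCount X B ω ≠ ∞) :
    HasSum (fun n => B.indicator (fun _ => (1 : ℝ)) (X n ω)) (pointCount X B ω).toReal := by
  have hf := finite_of_pointCount_ne_top h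
  have hs : Summable (fun n => B.indicator (fun _ => (1 : ℝ)) (X n ω)) :=
    summable_of_hasFiniteSupport (hf.subset fun n hn => by
      by_contra hc
      exact hn (Set.indicator_of_notMem (s := B) hc _))
  convert hs.hasSum
  rw [pointCount_eq_tsum, ENNReal.tsum_toReal_eq]
  · congr 1
    ext n
    by_cases hn : X n ω ∈ B <;> simp [hn]
  · intro n
    by_cases hn : X n ω ∈ B <;> simp [hn]

variable [MeasurableSpace Ω] [MeasurableSpace E] {Λ : Measure E} {P : Measure Ω}

namespace IsPoissonProcess

variable (hX : IsPoissonProcess X Λ P)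
include hX

lemma measurable_pointCount {B : Set E} (hB : MeasurableSet B) : Measurable (pointCount X B) := by
  have : pointCount X B = fun ω => ∑' n, B.indicator (fun _ => (1 : ℝ≥0∞)) (X n ω) := by
    ext ω
    exact pointCount_eq_tsum X B ω
  rw [this]
  exact Measurable.tsum fun n =>
    (measurable_const.indicator hB).comp (hX.measurable n)

lemma lintegral_pointCount {B : Set E} (hB : MeasurableSet B) (hfin : Λ B ≠ ∞) :
    ∫⁻ ω, pointCount X B ω ∂P = Λ B := by
  have h := hX.law_count B hB hfin
  have h1 : ∫⁻ ω, pointCount X B ω ∂P = ∫⁻ x, x ∂(P.map (pointCount X B)) := by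
    rw [lintegral_map measurable_id' (hX.measurable_pointCount hB)]
  rw [h1, h.map_eq, lintegral_map measurable_id' .of_discrete, lintegral_natCast_poissonMeasure]
  simp [hfin]

lemma ae_pointCount_ne_top {B : Set E} (hB : MeasurableSet B) (hfin : Λ B ≠ ∞) :
    ∀ᵐ ω ∂P, pointCount X B ω ≠ ∞ := by
  have := ae_lt_top (hX.measurable_pointCount hB) (by rwa [hX.lintegral_pointCount hB hfin])
  filter_upwards [this] with ω h using h.ne

lemma measure_pointCount_eq_zero {B : Set E} (hB : MeasurableSet B) (hfin : Λ B ≠ ∞) :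
    P {ω | pointCount X B ω = 0} = ENNReal.ofReal (Real.exp (-(Λ B).toReal)) := by
  have h := hX.law_count B hB hfin
  rw [h.measure_eq (p := fun x => x = 0) (measurableSet_singleton _),
    Measure.map_apply .of_discrete (by simp)]
  have : (Nat.cast : ℕ → ℝ≥0∞) ⁻¹' {x | x = 0} = {0} := by
    ext n
    simp
  rw [this, poissonMeasure_singleton]
  simp [ENNReal.coe_toNNReal_eq_toReal]

/-- The mean measure of a Poisson process is its intensity. -/
lemma sum_map_eq [SigmaFinite Λ] : Measure.sum (fun n => P.map (X n)) = Λ := by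
  have key : ∀ B, MeasurableSet B → Measure.sum (fun n => P.map (X n)) B
      = ∫⁻ ω, pointCount X B ω ∂P := by
    intro B hB
    rw [Measure.sum_apply _ hB]
    simp_rw [pointCount_eq_tsum]
    rw [lintegral_tsum (f := fun n ω => B.indicator (fun _ => (1 : ℝ≥0∞)) (X n ω))
      fun n => ((measurable_const.indicator hB).comp (hX.measurable n)).aemeasurable]
    congr 1
    ext n
    rw [Measure.map_apply (hX.measurable n) hB, ← lintegral_map
      (f := B.indicator fun _ => (1 : ℝ≥0∞)) (measurable_const.indicator hB) (hX.measurable n),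
      lintegral_indicator_const hB, one_mul, Measure.map_apply (hX.measurable n) hB]
  refine Measure.ext fun B hB => ?_
  -- The law of a count is prescribed only on sets of finite intensity, so `B` is cut into countably
  -- many such pieces.
  have hS : ∀ i, MeasurableSet (B ∩ disjointed (spanningSets Λ) i) := fun i =>
    hB.inter (.disjointed (measurableSet_spanningSets Λ) i)
  have hU : B = ⋃ i, B ∩ disjointed (spanningSets Λ) i := by
    rw [← inter_iUnion, iUnion_disjointed, iUnion_spanningSets, inter_univ]
  have hd : Pairwise (Function.onFun Disjoint fun i => B ∩ disjointed (spanningSets Λ) i) :=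
    fun i j hij => ((disjoint_disjointed (spanningSets Λ)) hij).mono inter_subset_right
      inter_subset_right
  rw [hU, measure_iUnion hd hS, measure_iUnion hd hS]
  congr 1
  ext i
  rw [key _ (hS i), hX.lintegral_pointCount (hS i)]
  exact ((measure_mono (inter_subset_right.trans (disjointed_subset _ _))).trans_lt
    (measure_spanningSets_lt_top Λ i)).ne

/-- Campbell's formula. -/
lemma lintegral_tsum_eq [SigmaFinite Λ] {g : E → ℝ≥0∞} (hg : Measurable g) :
    ∫⁻ ω, ∑' n, g (X n ω) ∂P = ∫⁻ x, g x ∂Λ := by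
  rw [lintegral_tsum (f := fun n ω => g (X n ω))
    fun n => (hg.comp (hX.measurable n)).aemeasurable]
  conv_rhs => rw [← hX.sum_map_eq, lintegral_sum_measure]
  congr 1
  ext n
  rw [lintegral_map hg (hX.measurable n)]

/-- As `Λ` is the sum of the laws of the individual points, a `Λ`-null set is null for each of these
laws. -/
lemma ae_forall_of_ae [SigmaFinite Λ] {p : E → Prop} (h : ∀ᵐ x ∂Λ, p x) :
    ∀ᵐ ω ∂P, ∀ n, p (X n ω) := by
  rw [ae_all_iff]
  intro n
  rw [← hX.sum_map_eq, Measure.ae_sum_iff] at h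
  exact ae_of_ae_map (hX.measurable n).aemeasurable (h n)

lemma ae_summable [SigmaFinite Λ] {g : E → ℝ} (hg : Measurable g) (hi : Integrable g Λ) :
    ∀ᵐ ω ∂P, Summable fun n => g (X n ω) := by
  have h1 : ∫⁻ ω, ∑' n, ‖g (X n ω)‖ₑ ∂P ≠ ∞ := by
    rw [hX.lintegral_tsum_eq (g := fun x => ‖g x‖ₑ) hg.enorm]
    exact hi.2.ne
  have hm : Measurable fun ω => ∑' n, ‖g (X n ω)‖ₑ :=
    Measurable.tsum fun n => (hg.comp (hX.measurable n)).enorm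
  filter_upwards [ae_lt_top hm h1] with ω hω
  refine Summable.of_norm ?_
  have := ENNReal.summable_toReal hω.ne
  simpa using this

lemma iIndepFun_pointCount {ι : Type*} [Fintype ι] {B : ι → Set E}
    (hB : ∀ i, MeasurableSet (B i)) (hd : Pairwise fun i j => Disjoint (B i) (B j)) :
    iIndepFun (fun i => pointCount X (B i)) P := by
  have e := Fintype.equivFin ι
  have h := hX.indep_count (Fintype.card ι) (fun j => B (e.symm j)) (fun j => hB _)
    (fun i j hij => hd (e.symm.injective.ne hij))
  have h2 := h.precomp e.injective
  simpa using h2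

lemma integral_exp_pointCount {B : Set E} (hB : MeasurableSet B) (hfin : Λ B ≠ ∞) (c : ℝ) :
    ∫ ω, Complex.exp (Complex.I * ((c * (pointCount X B ω).toReal : ℝ) : ℂ)) ∂P
      = Complex.exp (((Λ B).toReal : ℂ) * (Complex.exp (Complex.I * c) - 1)) := by
  have h := hX.law_count B hB hfin
  have h1 : ∫ ω, Complex.exp (Complex.I * ((c * (pointCount X B ω).toReal : ℝ) : ℂ)) ∂P
      = ∫ x : ℝ≥0∞, Complex.exp (Complex.I * ((c * x.toReal : ℝ) : ℂ))
        ∂(P.map (pointCount X B)) := by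
    rw [integral_map (hX.measurable_pointCount hB).aemeasurable]
    exact Measurable.aestronglyMeasurable (by fun_prop)
  have h2 := charFun_map_cast_poissonMeasure (Λ B).toNNReal c
  rw [h1, h.map_eq, integral_map .of_discrete (Measurable.aestronglyMeasurable (by fun_prop))]
  rw [charFun_apply, integral_map .of_discrete (by fun_prop)] at h2
  have e1 : Complex.I * (c : ℂ) = c * Complex.I := mul_comm _ _
  rw [e1]
  rw [← ENNReal.coe_toNNReal_eq_toReal, ← h2]
  congr 1
  ext n
  simp
  ring_nf

end IsPoissonProcess

/-- The level set of the value zero may have infinite intensity; `φ 0 = 0` allows it to be left out.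
The lemma serves both for `φ = id` and for `φ c = exp (i c) - 1`. -/
lemma SimpleFunc.eq_sum_indicator {F : Type*} [AddCommMonoid F] [DecidableEq ℝ]
    (s : SimpleFunc E ℝ) (φ : ℝ → F)
    (h0 : φ 0 = 0) (x : E) :
    φ (s x) = ∑ c : {c // c ∈ s.range.filter (· ≠ 0)},
      (s ⁻¹' {c.1}).indicator (fun _ => φ c.1) x := by
  rw [Finset.sum_coe_sort (s.range.filter (· ≠ 0))
    (fun c => (s ⁻¹' {c}).indicator (fun _ => φ c) x)]
  by_cases hx : s x = 0
  · rw [hx, h0, Finset.sum_eq_zero]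
    intro c hc
    refine indicator_of_notMem ?_ _
    simp only [Finset.mem_filter] at hc
    simp [hx, Ne.symm hc.2]
  · rw [Finset.sum_eq_single (s x)]
    · simp
    · intro c _ hc
      exact indicator_of_notMem (by simpa using Ne.symm hc) _
    · intro h
      simp [hx] at h

lemma norm_exp_I_mul_sub_exp_I_mul_le (x y : ℝ) :
    ‖Complex.exp (Complex.I * x) - Complex.exp (Complex.I * y)‖ ≤ |x - y| := by
  have : Complex.exp (Complex.I * x) - Complex.exp (Complex.I * y)
      = Complex.exp (Complex.I * y) * (Complex.exp (Complex.I * ((x - y : ℝ) : ℂ)) - 1) := by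
    rw [mul_sub, ← Complex.exp_add, mul_one]
    push_cast
    ring_nf
  rw [this, norm_mul, mul_comm Complex.I (y : ℂ), Complex.norm_exp_ofReal_mul_I, one_mul]
  exact Real.norm_exp_I_mul_ofReal_sub_one_le

lemma integrable_exp_I_mul_sub_one {g : E → ℝ} (hg : Measurable g) (hi : Integrable g Λ) :
    Integrable (fun x => Complex.exp (Complex.I * (g x : ℂ)) - 1) Λ :=
  hi.mono (Measurable.aestronglyMeasurable (by fun_prop))
    (ae_of_all _ fun x => Real.norm_exp_I_mul_ofReal_sub_one_le)

namespace IsPoissonProcess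

variable (hX : IsPoissonProcess X Λ P)
include hX

/-- For a simple function the sum over the points is a finite linear combination of counts in
disjoint level sets. These are independent Poisson variables, so the expectation is a product of
Poisson characteristic functions. -/
lemma integral_exp_tsum_simpleFunc [IsProbabilityMeasure P] (s : SimpleFunc E ℝ)
    (hs : Integrable s Λ) :
    ∫ ω, Complex.exp (Complex.I * ((∑' n, s (X n ω) : ℝ) : ℂ)) ∂P
      = Complex.exp (∫ x, (Complex.exp (Complex.I * (s x : ℂ)) - 1) ∂Λ) := by
  classical
  let ι := {c // c ∈ s.range.filter (· ≠ 0)}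
  let _ : Fintype ι := inferInstanceAs (Fintype {c // c ∈ s.range.filter (· ≠ 0)})
  have hB : ∀ c : ι, MeasurableSet (s ⁻¹' {c.1}) := fun c => s.measurableSet_preimage _
  have hfin : ∀ c : ι, Λ (s ⁻¹' {c.1}) ≠ ∞ := by
    intro c
    have hc := c.2
    simp only [Finset.mem_filter] at hc
    exact (SimpleFunc.measure_preimage_lt_top_of_integrable s hs hc.2).ne
  have hd : Pairwise fun i j : ι => Disjoint (s ⁻¹' {i.1}) (s ⁻¹' {j.1}) := by
    intro i j hij
    refine Disjoint.preimage _ ?_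
    simpa using fun h => hij (Subtype.ext h)
  have hind := hX.iIndepFun_pointCount hB hd
  have hsum : ∀ᵐ ω ∂P, Complex.exp (Complex.I * ((∑' n, s (X n ω) : ℝ) : ℂ))
      = ∏ c : ι, Complex.exp (Complex.I *
        ((c.1 * (pointCount X (s ⁻¹' {c.1}) ω).toReal : ℝ) : ℂ)) := by
    have hc : ∀ᵐ ω ∂P, ∀ c : ι, pointCount X (s ⁻¹' {c.1}) ω ≠ ∞ :=
      ae_all_iff.2 fun c => hX.ae_pointCount_ne_top (hB c) (hfin c)
    filter_upwards [hc] with ω hω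
    have h1 : HasSum (fun n => s (X n ω))
        (∑ c : ι, c.1 * (pointCount X (s ⁻¹' {c.1}) ω).toReal) := by
      have h2 : (fun n => s (X n ω)) = fun n => ∑ c : ι,
          c.1 * (s ⁻¹' {c.1}).indicator (fun _ => (1 : ℝ)) (X n ω) := by
        ext n
        have := SimpleFunc.eq_sum_indicator s id rfl (X n ω)
        simp only [id] at this
        rw [this]
        refine Finset.sum_congr rfl fun c _ => ?_
        simp [indicator_apply]
      rw [h2]
      exact hasSum_sum fun c _ => (hasSum_indicator_of_pointCount_ne_top (hω c)).mul_left _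
    rw [h1.tsum_eq, ← Complex.exp_sum]
    push_cast
    rw [Finset.mul_sum]
  rw [integral_congr_ae hsum]
  have hind2 : iIndepFun (fun (c : ι) ω => Complex.exp (Complex.I *
        ((c.1 * (pointCount X (s ⁻¹' {c.1}) ω).toReal : ℝ) : ℂ))) P :=
    hind.comp (fun c x => Complex.exp (Complex.I * ((c.1 * x.toReal : ℝ) : ℂ)))
      (fun c => by fun_prop)
  rw [hind2.integral_fun_prod_eq_prod_integral fun c => by
    have := hX.measurable_pointCount (hB c)
    exact Measurable.aestronglyMeasurable (by fun_prop)]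
  have hpr : ∀ c : ι, ∫ ω, Complex.exp (Complex.I *
        ((c.1 * (pointCount X (s ⁻¹' {c.1}) ω).toReal : ℝ) : ℂ)) ∂P
      = Complex.exp (((Λ (s ⁻¹' {c.1})).toReal : ℂ) * (Complex.exp (Complex.I * c.1) - 1)) :=
    fun c => hX.integral_exp_pointCount (hB c) (hfin c) c.1
  simp_rw [hpr]
  rw [← Complex.exp_sum]
  congr 1
  have h3 : ∀ x, (Complex.exp (Complex.I * (s x : ℂ)) - 1) = ∑ c : ι,
      (s ⁻¹' {c.1}).indicator (fun _ => Complex.exp (Complex.I * (c.1 : ℂ)) - 1) x :=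
    SimpleFunc.eq_sum_indicator s (fun c => Complex.exp (Complex.I * (c : ℂ)) - 1) (by simp)
  simp_rw [h3]
  rw [integral_finsetSum _ fun c _ => (integrableOn_const (hs := hfin c)).integrable_indicator
    (hB c)]
  refine Finset.sum_congr rfl fun c _ => ?_
  rw [integral_indicator_const _ (hB c)]
  simp [Measure.real]

/-- The characteristic functional of a Poisson process. -/
theorem integral_exp_tsum [SigmaFinite Λ] [IsProbabilityMeasure P] {g : E → ℝ}
    (hg : Measurable g) (hi : Integrable g Λ) :
    ∫ ω, Complex.exp (Complex.I * ((∑' n, g (X n ω) : ℝ) : ℂ)) ∂P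
      = Complex.exp (∫ x, (Complex.exp (Complex.I * (g x : ℂ)) - 1) ∂Λ) := by
  -- Both sides of the identity are continuous in `g` for the `L¹(Λ)` distance: `x ↦ exp (i x)` is
  -- 1-Lipschitz, and Campbell's formula bounds the mean difference of the two sums by that
  -- distance. Simple functions therefore suffice.
  let s : ℕ → SimpleFunc E ℝ := fun k => SimpleFunc.approxOn g hg (range g ∪ {0}) 0 (by simp) k
  have hsi : ∀ k, Integrable (s k) Λ := SimpleFunc.integrable_approxOn_range hg hi
  have hs0 : Tendsto (fun k => ∫⁻ x, ‖s k x - g x‖ₑ ∂Λ) atTop (𝓝 0) :=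
    SimpleFunc.tendsto_approxOn_range_L1_enorm hg hi
  have hmeas : ∀ {f : E → ℝ}, Measurable f → Integrable f Λ → AEStronglyMeasurable
      (fun ω => Complex.exp (Complex.I * ((∑' n, f (X n ω) : ℝ) : ℂ))) P := by
    intro f hf hfi
    have : AEMeasurable (fun ω => ∑' n, f (X n ω)) P := by
      refine aemeasurable_of_tendsto_metrizable_ae atTop
        (f := fun N ω => ∑ n ∈ Finset.range N, f (X n ω)) (fun N => ?_) ?_
      · exact (Finset.measurable_sum _ fun n _ => hf.comp (hX.measurable n)).aemeasurable
      · filter_upwards [hX.ae_summable hf hfi] with ω hω using hω.hasSum.tendsto_sum_nat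
    exact AEMeasurable.aestronglyMeasurable (by fun_prop)
  have hint : ∀ {f : E → ℝ}, Measurable f → Integrable f Λ → Integrable
      (fun ω => Complex.exp (Complex.I * ((∑' n, f (X n ω) : ℝ) : ℂ))) P := by
    intro f hf hfi
    refine Integrable.of_bound (hmeas hf hfi) 1 (ae_of_all _ fun ω => ?_)
    rw [mul_comm, Complex.norm_exp_ofReal_mul_I]
  have hL : Tendsto (fun k => ∫ ω, Complex.exp (Complex.I * ((∑' n, s k (X n ω) : ℝ) : ℂ)) ∂P)
      atTop (𝓝 (∫ ω, Complex.exp (Complex.I * ((∑' n, g (X n ω) : ℝ) : ℂ)) ∂P)) := by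
    refine tendsto_integral_of_L1 _ (hmeas hg hi)
      (Eventually.of_forall fun k => hint (s k).measurable (hsi k)) ?_
    refine tendsto_of_tendsto_of_tendsto_of_le_of_le tendsto_const_nhds hs0
      (fun _ => zero_le) fun k => ?_
    have hmk : Measurable fun x => ‖s k x - g x‖ₑ := ((s k).measurable.sub hg).enorm
    simp only
    rw [← hX.lintegral_tsum_eq hmk]
    refine lintegral_mono_ae ?_
    filter_upwards [hX.ae_summable hg hi, hX.ae_summable (s k).measurable (hsi k)] with ω h1 h2
    have h3 := h2.sub h1
    rw [← ofReal_norm]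
    refine (ENNReal.ofReal_le_ofReal (norm_exp_I_mul_sub_exp_I_mul_le _ _)).trans ?_
    rw [← h2.tsum_sub h1, ← Real.norm_eq_abs, ofReal_norm]
    exact enorm_tsum_le_tsum_enorm
  have hR : Tendsto (fun k => ∫ x, (Complex.exp (Complex.I * (s k x : ℂ)) - 1) ∂Λ)
      atTop (𝓝 (∫ x, (Complex.exp (Complex.I * (g x : ℂ)) - 1) ∂Λ)) := by
    refine tendsto_integral_of_L1 _ (integrable_exp_I_mul_sub_one hg hi).aestronglyMeasurable
      (Eventually.of_forall fun k => integrable_exp_I_mul_sub_one (s k).measurable (hsi k)) ?_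
    refine tendsto_of_tendsto_of_tendsto_of_le_of_le tendsto_const_nhds hs0
      (fun _ => zero_le) fun k => ?_
    refine lintegral_mono fun x => ?_
    rw [sub_sub_sub_cancel_right, ← ofReal_norm, ← ofReal_norm]
    exact ENNReal.ofReal_le_ofReal (norm_exp_I_mul_sub_exp_I_mul_le _ _)
  refine tendsto_nhds_unique hL ?_
  simp_rw [fun k => hX.integral_exp_tsum_simpleFunc (s k) (hsi k)]
  exact (Complex.continuous_exp.tendsto _).comp hR

end IsPoissonProcess

end PoissonProcess

/-! ### Measures on the line determined by half-lines; the radial measure. -/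

/-- Only half-lines need finite mass, since `radialMeasure` has infinite total mass when its scale
is positive. -/
lemma MeasureTheory.Measure.ext_of_Iic_of_ne_top {μ ν : Measure ℝ} (hfin : ∀ a, μ (Iic a) ≠ ∞)
    (h : ∀ a, μ (Iic a) = ν (Iic a)) : μ = ν := by
  refine Measure.ext_of_generateFrom_of_iUnion (range Iic) (fun n : ℕ => Iic (n : ℝ)) ?_
    isPiSystem_Iic ?_ (fun n => mem_range_self _) (fun n => hfin _) ?_
  · rw [← borel_eq_generateFrom_Iic, BorelSpace.measurable_eq (α := ℝ)]
  · refine eq_univ_of_forall fun x => ?_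
    obtain ⟨n, hn⟩ := exists_nat_ge x
    exact mem_iUnion.2 ⟨n, hn⟩
  · rintro _ ⟨a, rfl⟩
    exact h a

lemma lintegral_Ioc_ofReal_of_hasDerivAt {F f : ℝ → ℝ} {a b : ℝ} (hab : a ≤ b)
    (hf : Continuous f) (hd : ∀ x, HasDerivAt F (f x) x) (h0 : ∀ x ∈ Ioc a b, 0 ≤ f x) :
    ∫⁻ x in Ioc a b, ENNReal.ofReal (f x) = ENNReal.ofReal (F b - F a) := by
  rw [← ofReal_integral_eq_lintegral_ofReal (hf.integrableOn_Icc.mono_set Ioc_subset_Icc_self)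
    ((ae_restrict_iff' measurableSet_Ioc).2 (ae_of_all _ h0)),
    ← intervalIntegral.integral_of_le hab,
    intervalIntegral.integral_eq_sub_of_hasDerivAt (fun x _ => hd x) (hf.intervalIntegrable _ _)]

/-- The image under the norm of Lebesgue measure on the plane, with distances scaled. -/
noncomputable def radialMeasure (c : ℝ) : Measure ℝ :=
  (volume.restrict (Ioi 0)).withDensity (fun r => ENNReal.ofReal (2 * Real.pi * c * r))

lemma withDensity_restrict_Ioi_Iic (f : ℝ → ℝ≥0∞) (r : ℝ) :
    (volume.restrict (Ioi 0)).withDensity f (Iic r) = ∫⁻ x in Ioc 0 r, f x := by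
  rw [withDensity_apply _ measurableSet_Iic, Measure.restrict_restrict measurableSet_Iic,
    inter_comm, Ioi_inter_Iic]

lemma radialMeasure_Iic {c : ℝ} (hc : 0 ≤ c) (r : ℝ) :
    radialMeasure c (Iic r) = ENNReal.ofReal (Real.pi * c * (max r 0) ^ 2) := by
  rw [radialMeasure, withDensity_restrict_Ioi_Iic]
  rcases le_total r 0 with h | h
  · simp [h]
  · rw [lintegral_Ioc_ofReal_of_hasDerivAt (F := fun x => Real.pi * c * x ^ 2) h (by fun_prop),
      max_eq_left h]
    · simp
    · intro x
      refine ((hasDerivAt_pow 2 x).const_mul (Real.pi * c)).congr_deriv ?_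
      norm_num
      ring
    · intro x hx
      have := hx.1
      positivity

/-! ### Equivalent distances and the powers expressed through them. -/

namespace Network

variable (N : Network)

lemma α_pos : 0 < N.α := by linarith [N.two_lt_α]

lemma cellRadius_pos : 0 < N.cellRadius :=
  Real.rpow_pos_of_pos (div_pos N.β_pos (mul_pos N.A_pos N.PB_pos)) _

/-- The factor by which lognormal fading scales the intensity of equivalent distances. -/
noncomputable def fadingScale : ℝ := Real.exp (2 * N.σ ^ 2 / N.α ^ 2)

lemma fadingScale_pos : 0 < N.fadingScale := Real.exp_pos _

instance : IsProbabilityMeasure N.fadingLaw :=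
  Measure.isProbabilityMeasure_map (by fun_prop)

lemma ae_fadingLaw_pos : ∀ᵐ h ∂N.fadingLaw, 0 < h := by
  rw [fadingLaw, ae_map_iff (by fun_prop) measurableSet_Ioi]
  exact ae_of_all _ Real.exp_pos

lemma measurable_equivDist : Measurable fun p : ℝ × ℝ => N.equivDist p.1 p.2 := by
  unfold equivDist
  fun_prop

@[fun_prop]
lemma measurable_equivDist_comp {E : Type*} [MeasurableSpace E] {f g : E → ℝ} (hf : Measurable f)
    (hg : Measurable g) : Measurable fun x => N.equivDist (f x) (g x) :=
  N.measurable_equivDist.comp (hf.prodMk hg)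

/-- This is the Gaussian moment generating function at `2/α`: `σ² (2/α)² / 2 = 2σ²/α²`. -/
lemma lintegral_rpow_fadingLaw (c : ℝ) (hc : 0 ≤ c) :
    ∫⁻ h, ENNReal.ofReal (c * h ^ (2 / N.α)) ∂N.fadingLaw = ENNReal.ofReal (c * N.fadingScale) := by
  rw [fadingLaw, lintegral_map (by fun_prop) (by fun_prop)]
  have h1 : ∀ x : ℝ, c * Real.exp x ^ (2 / N.α) = c * Real.exp ((2 / N.α) * x) := by
    intro x
    rw [← Real.exp_mul, mul_comm x]
  simp_rw [h1]
  rw [← ofReal_integral_eq_lintegral_ofReal ((integrable_exp_mul_gaussianReal _).const_mul c)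
    (ae_of_all _ fun x => by positivity), integral_const_mul]
  have h2 := congrFun (mgf_id_gaussianReal (μ := 0) (v := Real.toNNReal (N.σ ^ 2))) (2 / N.α)
  simp only [mgf, id] at h2
  rw [h2, fadingScale, Real.coe_toNNReal _ (sq_nonneg _)]
  congr 3
  field_simp
  ring

lemma equivDist_le_iff {h r : ℝ} (hh : 0 < h) (R : ℝ) :
    N.equivDist R h ≤ r ↔ R ≤ h ^ (1 / N.α) * r := by
  rw [equivDist, neg_div, Real.rpow_neg hh.le, inv_mul_le_iff₀ (Real.rpow_pos_of_pos hh _)]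

/-- At fixed fading `h` the preimage of `Iic r` is the disc of radius `h^(1/α) r`, so averaging its
area over `h` multiplies `π r²` by the moment of order `2/α` of the fading. -/
lemma map_equivDist : ((volume : Measure Plane).prod N.fadingLaw).map
    (fun p => N.equivDist ‖p.1‖ p.2) = radialMeasure N.fadingScale := by
  have key : ∀ r, ((volume : Measure Plane).prod N.fadingLaw).map
      (fun p => N.equivDist ‖p.1‖ p.2) (Iic r) = radialMeasure N.fadingScale (Iic r) := by
    intro r
    have hm : Measurable fun p : Plane × ℝ => N.equivDist ‖p.1‖ p.2 := by fun_prop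
    rw [Measure.map_apply hm measurableSet_Iic,
      Measure.prod_apply_symm (hm measurableSet_Iic), radialMeasure_Iic N.fadingScale_pos.le]
    rw [show Real.pi * N.fadingScale * max r 0 ^ 2 = (Real.pi * max r 0 ^ 2) * N.fadingScale by ring,
      ← N.lintegral_rpow_fadingLaw _ (by positivity)]
    refine lintegral_congr_ae ?_
    filter_upwards [N.ae_fadingLaw_pos] with h hh
    have hset : (fun x : Plane => (x, h)) ⁻¹' ((fun p : Plane × ℝ => N.equivDist ‖p.1‖ p.2) ⁻¹' Iic r)
        = Metric.closedBall 0 (h ^ (1 / N.α) * r) := by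
      ext x
      simp [N.equivDist_le_iff hh]
    rw [hset, EuclideanSpace.volume_closedBall_fin_two]
    have hp : 0 < h ^ (1 / N.α) := Real.rpow_pos_of_pos hh _
    -- For negative `r` the disc is empty; `max r 0` treats both signs at once.
    have e1 : ENNReal.ofReal (h ^ (1 / N.α) * r) = ENNReal.ofReal (h ^ (1 / N.α) * max r 0) := by
      rcases le_total r 0 with h0 | h0
      · rw [max_eq_right h0, ENNReal.ofReal_of_nonpos (mul_nonpos_of_nonneg_of_nonpos hp.le h0)]
        simp
      · rw [max_eq_left h0]
    rw [e1, ← ENNReal.ofReal_pow (by positivity), ← ENNReal.ofReal_mul (by positivity)]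
    congr 1
    have e2 : h ^ (2 / N.α) = (h ^ (1 / N.α)) ^ 2 := by
      rw [← Real.rpow_natCast, ← Real.rpow_mul hh.le]
      congr 1
      push_cast
      ring
    rw [e2]
    ring
  refine Measure.ext_of_Iic_of_ne_top (fun a => ?_) key
  rw [key, radialMeasure_Iic N.fadingScale_pos.le]
  exact ENNReal.ofReal_ne_top

lemma ae_pos_pos : ∀ᵐ p ∂((volume : Measure Plane).prod N.fadingLaw), 0 < ‖p.1‖ ∧ 0 < p.2 := by
  have h1 : ∀ᵐ x ∂(volume : Measure Plane), 0 < ‖x‖ := by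
    have : ∀ᵐ x ∂(volume : Measure Plane), x ≠ 0 := by
      simp [ae_iff]
    filter_upwards [this] with x hx using norm_pos_iff.2 hx
  exact (Measure.quasiMeasurePreserving_fst.ae h1).and
    (Measure.quasiMeasurePreserving_snd.ae N.ae_fadingLaw_pos)

variable {N}

lemma equivDist_pos {R h : ℝ} (hR : 0 < R) (hh : 0 < h) : 0 < N.equivDist R h :=
  mul_pos (Real.rpow_pos_of_pos hh _) hR

lemma equivDist_rpow {R h : ℝ} (hR : 0 < R) (hh : 0 < h) :
    N.equivDist R h ^ N.α = h⁻¹ * R ^ N.α := by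
  have := N.α_pos
  rw [equivDist, Real.mul_rpow (Real.rpow_nonneg hh.le _) hR.le, ← Real.rpow_mul hh.le,
    div_mul_cancel₀ _ this.ne', Real.rpow_neg_one]

lemma gain_eq {R h : ℝ} (hR : 0 < R) (hh : 0 < h) :
    N.gain R h = N.A * N.equivDist R h ^ (-N.α) := by
  rw [Real.rpow_neg (equivDist_pos hR hh).le, equivDist_rpow hR hh, gain, Real.rpow_neg hR.le]
  rw [mul_inv, inv_inv]
  ring

lemma uplinkTxPower_eq {R h : ℝ} (hR : 0 < R) (hh : 0 < h) :
    N.uplinkTxPower R h = N.P0 * N.A ^ (-N.ε) * N.equivDist R h ^ (N.α * N.ε) := by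
  have := N.A_pos
  rw [uplinkTxPower, Real.rpow_mul (equivDist_pos hR hh).le, equivDist_rpow hR hh,
    show R ^ N.α / (h * N.A) = N.A⁻¹ * (h⁻¹ * R ^ N.α) by field_simp,
    Real.mul_rpow (by positivity) (by positivity), Real.rpow_neg this.le,
    Real.inv_rpow this.le, mul_assoc]

lemma downlinkPower_eq {R h : ℝ} (hR : 0 < R) (hh : 0 < h) :
    N.downlinkPower R h = N.PB * N.A * N.equivDist R h ^ (-N.α) := by
  rw [downlinkPower, gain_eq hR hh, mul_assoc]

lemma β_eq : N.β = N.PB * N.A * N.cellRadius ^ (-N.α) := by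
  have := N.α_pos
  have h1 := N.PB_pos
  have h2 := N.A_pos
  have h3 := N.β_pos
  rw [cellRadius, ← Real.rpow_mul (by positivity), show -1 / N.α * -N.α = 1 by field_simp,
    Real.rpow_one]
  field_simp

lemma power_le_power_iff {x y : ℝ} (hx : 0 < x) (hy : 0 < y) :
    N.PB * N.A * x ^ (-N.α) ≤ N.PB * N.A * y ^ (-N.α) ↔ y ≤ x := by
  rw [mul_le_mul_iff_right₀ (mul_pos N.PB_pos N.A_pos),
    Real.rpow_le_rpow_iff_of_neg hx hy (by linarith [N.α_pos])]

lemma downlinkPower_le_iff {R h R' h' : ℝ} (hR : 0 < R) (hh : 0 < h) (hR' : 0 < R') (hh' : 0 < h') :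
    N.downlinkPower R h ≤ N.downlinkPower R' h' ↔ N.equivDist R' h' ≤ N.equivDist R h := by
  rw [downlinkPower_eq hR hh, downlinkPower_eq hR' hh',
    power_le_power_iff (equivDist_pos hR hh) (equivDist_pos hR' hh')]

lemma downlinkPower_le_β_iff {R h : ℝ} (hR : 0 < R) (hh : 0 < h) :
    N.downlinkPower R h ≤ N.β ↔ N.cellRadius ≤ N.equivDist R h := by
  rw [downlinkPower_eq hR hh, β_eq, power_le_power_iff (equivDist_pos hR hh) N.cellRadius_pos]

end Network

/-! ### The typical user: nearest equivalent distance, mode and serving link. -/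

lemma measurable_sInf_nat {Ω : Type*} [MeasurableSpace Ω] {S : Ω → Set ℕ}
    (hS : ∀ n, MeasurableSet {ω | n ∈ S ω}) : Measurable fun ω => sInf (S ω) := by
  refine measurable_to_countable' fun n => ?_
  -- The second piece covers the convention `sInf ∅ = 0`.
  have : (fun ω => sInf (S ω)) ⁻¹' {n} =
      ({ω | n ∈ S ω} ∩ ⋂ m ∈ Iio n, {ω | m ∈ S ω}ᶜ) ∪
        ({_ω | n = 0} ∩ ⋂ m, {ω | m ∈ S ω}ᶜ) := by
    ext ω
    simp only [mem_preimage, mem_singleton_iff, mem_union, mem_inter_iff, mem_ofPred_eq, mem_iInter,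
      mem_compl_iff, mem_Iio]
    constructor
    · rintro rfl
      rcases (S ω).eq_empty_or_nonempty with h | h
      · right
        simp [h]
      · exact Or.inl ⟨Nat.sInf_mem h, fun m hm => Nat.notMem_of_lt_sInf hm⟩
    · rintro (⟨h1, h2⟩ | ⟨rfl, h2⟩)
      · refine le_antisymm (Nat.sInf_le h1) ?_
        by_contra! hc
        exact h2 _ hc (Nat.sInf_mem ⟨n, h1⟩)
      · rw [eq_empty_of_forall_notMem h2, Nat.sInf_empty]
  rw [this]
  exact ((hS n).inter (.biInter (to_countable _) fun m _ => (hS m).compl)).union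
    ((MeasurableSet.const _).inter (.iInter fun m => (hS m).compl))

namespace Network

variable (N : Network)

instance : SigmaFinite N.bsIntensity :=
  inferInstanceAs (SigmaFinite (Real.toNNReal N.lamB • (volume : Measure Plane).prod N.fadingLaw))

lemma ae_bsIntensity_pos : ∀ᵐ p ∂N.bsIntensity, 0 < ‖p.1‖ ∧ 0 < p.2 :=
  Measure.ae_smul_measure N.ae_pos_pos _

lemma bsIntensity_equivDist_le (r : ℝ) :
    N.bsIntensity {p | N.equivDist ‖p.1‖ p.2 ≤ r}
      = ENNReal.ofReal (Real.pi * N.lamB * N.fadingScale * (max r 0) ^ 2) := by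
  have h : ((volume : Measure Plane).prod N.fadingLaw).map (fun p => N.equivDist ‖p.1‖ p.2) (Iic r)
    = radialMeasure N.fadingScale (Iic r) := by rw [N.map_equivDist]
  rw [Measure.map_apply (by fun_prop) measurableSet_Iic,
    radialMeasure_Iic N.fadingScale_pos.le] at h
  rw [bsIntensity, Measure.smul_apply, smul_eq_mul]
  change _ * ((volume : Measure Plane).prod N.fadingLaw) ((fun p => N.equivDist ‖p.1‖ p.2) ⁻¹' Iic r) = _
  rw [h, ← ENNReal.ofReal_mul N.lamB_pos.le]
  congr 1
  ring

lemma measurable_downlinkPower {E : Type*} [MeasurableSpace E] {f g : E → ℝ} (hf : Measurable f)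
    (hg : Measurable g) : Measurable fun x => N.downlinkPower (f x) (g x) := by
  unfold downlinkPower gain
  fun_prop

section Serving

variable {Ω₀ : Type*} [MeasurableSpace Ω₀] {P₀ : Measure Ω₀} {Φb : ℕ → Ω₀ → Plane × ℝ}

lemma measurable_servingLink (hm : ∀ n, Measurable (Φb n)) :
    Measurable fun ω => N.servingLink (fun n => Φb n ω) := by
  have hp : ∀ n, Measurable fun ω => N.downlinkPower ‖(Φb n ω).1‖ (Φb n ω).2 := fun n =>
    N.measurable_downlinkPower (hm n).fst.norm (hm n).snd
  have hidx : Measurable fun ω => N.servingIndex (fun n => Φb n ω) := by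
    refine measurable_sInf_nat fun n => ?_
    have : {ω | n ∈ {n | ∀ m, N.downlinkPower ‖(Φb m ω).1‖ (Φb m ω).2
        ≤ N.downlinkPower ‖(Φb n ω).1‖ (Φb n ω).2}} = ⋂ m, {ω | N.downlinkPower ‖(Φb m ω).1‖
        (Φb m ω).2 ≤ N.downlinkPower ‖(Φb n ω).1‖ (Φb n ω).2} := by
      ext ω
      simp
    rw [this]
    exact .iInter fun m => measurableSet_le (hp m) (hp n)
  have h2 : Measurable fun q : ℕ × Ω₀ => Φb q.1 q.2 := measurable_from_prod_countable_right hm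
  have h3 : Measurable fun ω => Φb (N.servingIndex (fun n => Φb n ω)) ω :=
    h2.comp (hidx.prodMk measurable_id)
  exact h3.fst.norm.prodMk h3.snd

/-- The smallest equivalent distance from the typical user to a base station. -/
noncomputable def nearestDist (Φb : ℕ → Ω₀ → Plane × ℝ) (ω : Ω₀) : ℝ :=
  N.equivDist (N.servingLink fun n => Φb n ω).1 (N.servingLink fun n => Φb n ω).2

lemma measurable_nearestDist (hm : ∀ n, Measurable (Φb n)) : Measurable (N.nearestDist Φb) :=
  N.measurable_equivDist.comp (N.measurable_servingLink hm)

variable (hb : IsPoissonProcess Φb N.bsIntensity P₀)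
include hb

lemma ae_forall_pos : ∀ᵐ ω ∂P₀, ∀ n, 0 < ‖(Φb n ω).1‖ ∧ 0 < (Φb n ω).2 :=
  hb.ae_forall_of_ae N.ae_bsIntensity_pos

lemma ae_servingLink_pos : ∀ᵐ ω ∂P₀, 0 < (N.servingLink fun n => Φb n ω).1 ∧
    0 < (N.servingLink fun n => Φb n ω).2 := by
  filter_upwards [N.ae_forall_pos hb] with ω hω using hω _

/-- Almost surely only finitely many stations lie within any given equivalent distance, so the
minimum is attained. The set in `servingIndex` is then nonempty, and its `sInf` is a genuine
strongest station. -/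
lemma ae_nearestDist_le : ∀ᵐ ω ∂P₀, ∀ n,
    N.nearestDist Φb ω ≤ N.equivDist ‖(Φb n ω).1‖ (Φb n ω).2 := by
  have hm : Measurable fun p : Plane × ℝ => N.equivDist ‖p.1‖ p.2 := by fun_prop
  have hfin : ∀ᵐ ω ∂P₀, ∀ k : ℕ, pointCount Φb {p | N.equivDist ‖p.1‖ p.2 ≤ k} ω ≠ ∞ := by
    rw [ae_all_iff]
    intro k
    refine hb.ae_pointCount_ne_top (hm measurableSet_Iic) ?_
    rw [bsIntensity_equivDist_le]
    exact ENNReal.ofReal_ne_top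
  filter_upwards [hfin, N.ae_forall_pos hb] with ω h1 h2
  obtain ⟨k, hk⟩ := exists_nat_ge (N.equivDist ‖(Φb 0 ω).1‖ (Φb 0 ω).2)
  obtain ⟨n, hn, hmin⟩ := Set.exists_min_image _
    (fun n => N.equivDist ‖(Φb n ω).1‖ (Φb n ω).2) (finite_of_pointCount_ne_top (h1 k)) ⟨0, hk⟩
  have hall : ∀ m, N.equivDist ‖(Φb n ω).1‖ (Φb n ω).2 ≤ N.equivDist ‖(Φb m ω).1‖ (Φb m ω).2 := by
    intro m
    by_cases hmk : Φb m ω ∈ {p : Plane × ℝ | N.equivDist ‖p.1‖ p.2 ≤ k}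
    · exact hmin m hmk
    · exact le_trans hn (le_of_lt (not_le.1 hmk))
  have hne : {n | ∀ m, N.downlinkPower ‖(Φb m ω).1‖ (Φb m ω).2
      ≤ N.downlinkPower ‖(Φb n ω).1‖ (Φb n ω).2}.Nonempty :=
    ⟨n, fun m => (downlinkPower_le_iff (h2 m).1 (h2 m).2 (h2 n).1 (h2 n).2).2 (hall m)⟩
  intro m
  exact (downlinkPower_le_iff (h2 m).1 (h2 m).2 (h2 _).1 (h2 _).2).1 (Nat.sInf_mem hne m)

/-- The rate in the Rayleigh law of the smallest equivalent distance. -/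
noncomputable def nearestRate : ℝ := Real.pi * N.lamB * N.fadingScale

omit hb in
lemma nearestRate_pos : 0 < N.nearestRate :=
  mul_pos (mul_pos Real.pi_pos N.lamB_pos) N.fadingScale_pos

/-- The void probability: the nearest distance exceeds `r` exactly when no station has equivalent
distance at most `r`. -/
lemma measure_nearestDist_gt (r : ℝ) : P₀ {ω | r < N.nearestDist Φb ω}
    = ENNReal.ofReal (Real.exp (-N.nearestRate * (max r 0) ^ 2)) := by
  have hm : Measurable fun p : Plane × ℝ => N.equivDist ‖p.1‖ p.2 := by fun_prop
  have hr := N.nearestRate_pos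
  have h := hb.measure_pointCount_eq_zero (B := {p | N.equivDist ‖p.1‖ p.2 ≤ r})
    (hm measurableSet_Iic) (by rw [bsIntensity_equivDist_le]; exact ENNReal.ofReal_ne_top)
  rw [bsIntensity_equivDist_le, ← nearestRate, ENNReal.toReal_ofReal (by positivity),
    ← neg_mul] at h
  rw [← h]
  refine measure_congr ?_
  filter_upwards [N.ae_nearestDist_le hb] with ω hω
  refine propext ?_
  change r < N.nearestDist Φb ω ↔ pointCount Φb _ ω = 0
  rw [pointCount, Measure.count_eq_zero_iff]
  constructor
  · intro hlt
    refine eq_empty_of_forall_notMem fun n hn => ?_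
    exact absurd (hlt.trans_le (hω n)) (not_lt.2 hn)
  · intro he
    by_contra! hc
    exact (eq_empty_iff_forall_notMem.1 he) (N.servingIndex fun n => Φb n ω) hc

lemma map_nearestDist [IsProbabilityMeasure P₀] : P₀.map (N.nearestDist Φb) =
    (volume.restrict (Ioi 0)).withDensity fun x =>
      ENNReal.ofReal (2 * N.nearestRate * x * Real.exp (-N.nearestRate * x ^ 2)) := by
  have hmD := N.measurable_nearestDist hb.measurable
  have hr := N.nearestRate_pos
  have := Measure.isProbabilityMeasure_map (μ := P₀) hmD.aemeasurable
  refine Measure.ext_of_Iic_of_ne_top (fun a => measure_ne_top _ _) fun r => ?_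
  have h1 : P₀.map (N.nearestDist Φb) (Iic r)
      = ENNReal.ofReal (1 - Real.exp (-N.nearestRate * (max r 0) ^ 2)) := by
    rw [← compl_Ioi, prob_compl_eq_one_sub measurableSet_Ioi,
      Measure.map_apply hmD measurableSet_Ioi]
    change 1 - P₀ {ω | r < N.nearestDist Φb ω} = _
    rw [N.measure_nearestDist_gt hb, ENNReal.ofReal_sub _ (Real.exp_pos _).le, ENNReal.ofReal_one]
  rw [h1, withDensity_restrict_Ioi_Iic]
  rcases le_total r 0 with h | h
  · simp [h]
  · rw [lintegral_Ioc_ofReal_of_hasDerivAt (F := fun x => -Real.exp (-N.nearestRate * x ^ 2)) h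
      (by fun_prop), max_eq_left h]
    · congr 1
      simp
      ring
    · intro x
      refine ((((hasDerivAt_pow 2 x).const_mul (-N.nearestRate)).exp).neg).congr_deriv ?_
      norm_num
      ring
    · intro x hx
      have := hx.1
      positivity

lemma cellularEvent_ae_eq : N.cellularEvent Φb =ᵐ[P₀] N.nearestDist Φb ⁻¹' Iio N.cellRadius := by
  filter_upwards [N.ae_nearestDist_le hb, N.ae_forall_pos hb] with ω h1 h2
  refine propext ?_
  change ENNReal.ofReal N.β < _ ↔ N.nearestDist Φb ω < N.cellRadius
  rw [lt_iSup_iff]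
  have : ∀ n, ENNReal.ofReal N.β < ENNReal.ofReal (N.downlinkPower ‖(Φb n ω).1‖ (Φb n ω).2) ↔
      N.equivDist ‖(Φb n ω).1‖ (Φb n ω).2 < N.cellRadius := by
    intro n
    rw [ENNReal.ofReal_lt_ofReal_iff_of_nonneg N.β_pos.le, ← not_le, ← not_le,
      downlinkPower_le_β_iff (h2 n).1 (h2 n).2]
  simp_rw [this]
  exact ⟨fun ⟨n, hn⟩ => (h1 n).trans_lt hn, fun h => ⟨_, h⟩⟩

lemma measure_cellularEvent [IsProbabilityMeasure P₀] : P₀ (N.cellularEvent Φb)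
    = ENNReal.ofReal (1 - Real.exp (-N.nearestRate * N.cellRadius ^ 2)) := by
  have hmD := N.measurable_nearestDist hb.measurable
  rw [measure_congr (N.cellularEvent_ae_eq hb), ← Measure.map_apply hmD measurableSet_Iio]
  -- The law has a density, so the boundary value `t` carries no mass.
  have hIio : P₀.map (N.nearestDist Φb) (Iio N.cellRadius) = P₀.map (N.nearestDist Φb) (Iic N.cellRadius) := by
    refine measure_congr (Iio_ae_eq_Iic' ?_)
    rw [N.map_nearestDist hb]
    exact withDensity_absolutelyContinuous _ _ (by simp)
  have := Measure.isProbabilityMeasure_map (μ := P₀) hmD.aemeasurable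
  rw [hIio, ← compl_Ioi, prob_compl_eq_one_sub measurableSet_Ioi,
      Measure.map_apply hmD measurableSet_Ioi]
  change 1 - P₀ {ω | _ < N.nearestDist Φb ω} = _
  rw [N.measure_nearestDist_gt hb, ENNReal.ofReal_sub _ (Real.exp_pos _).le, ENNReal.ofReal_one,
    max_eq_left N.cellRadius_pos.le]

omit hb in
lemma exp_neg_rate_lt_one : Real.exp (-N.nearestRate * N.cellRadius ^ 2) < 1 := by
  have := N.nearestRate_pos
  have := N.cellRadius_pos
  rw [Real.exp_lt_one_iff]
  nlinarith [mul_pos N.nearestRate_pos (pow_pos N.cellRadius_pos 2)]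

/-- This keeps the D2D intensity positive, on which the decay of the characteristic function rests.
-/
lemma cellularProb_lt_one [IsProbabilityMeasure P₀] : N.cellularProb Φb P₀ < 1 := by
  rw [cellularProb, Measure.real, N.measure_cellularEvent hb,
    ENNReal.toReal_ofReal (by linarith [N.exp_neg_rate_lt_one])]
  linarith [Real.exp_pos (-N.nearestRate * N.cellRadius ^ 2)]

omit hb in
lemma cellRadius_sq : N.cellRadius ^ 2 = (N.A * N.PB / N.β) ^ (2 / N.α) := by
  have h1 := N.PB_pos
  have h2 := N.A_pos
  have h3 := N.β_pos
  rw [cellRadius, ← Real.rpow_natCast, ← Real.rpow_mul (by positivity),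
    show N.β / (N.A * N.PB) = (N.A * N.PB / N.β)⁻¹ by rw [inv_div],
    Real.inv_rpow (by positivity), ← Real.rpow_neg (by positivity)]
  congr 1
  push_cast
  ring

omit hb in
lemma servingPdf_eq (r : ℝ) : N.servingPdf r =
    (1 - Real.exp (-N.nearestRate * N.cellRadius ^ 2))⁻¹ *
      (2 * N.nearestRate * r * Real.exp (-N.nearestRate * r ^ 2)) := by
  rw [servingPdf, cellRadius_sq, Real.exp_add, nearestRate, fadingScale, div_eq_inv_mul,
    show -Real.pi * N.lamB * r ^ 2 * Real.exp (2 * N.σ ^ 2 / N.α ^ 2)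
      = -(Real.pi * N.lamB * Real.exp (2 * N.σ ^ 2 / N.α ^ 2)) * r ^ 2 by ring,
    show -Real.pi * N.lamB * (N.A * N.PB / N.β) ^ (2 / N.α) * Real.exp (2 * N.σ ^ 2 / N.α ^ 2)
      = -(Real.pi * N.lamB * Real.exp (2 * N.σ ^ 2 / N.α ^ 2)) *
        (N.A * N.PB / N.β) ^ (2 / N.α) by ring]
  ring

/-- The law of the equivalent serving distance of a cellular user. -/
noncomputable def servingDistLaw : Measure ℝ :=
  (volume.restrict (Ioc 0 N.cellRadius)).withDensity (fun r => ENNReal.ofReal (N.servingPdf r))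

/-- Conditioning on cellular mode restricts the Rayleigh law to distances below `t` and divides by
the mass that is left, which is the denominator of `servingPdf`. -/
lemma map_servingLaw [IsProbabilityMeasure P₀] :
    (N.servingLaw Φb P₀).map (fun l => N.equivDist l.1 l.2) = N.servingDistLaw := by
  have hmD := N.measurable_nearestDist hb.measurable
  have hlt := N.exp_neg_rate_lt_one
  rw [servingLaw, Measure.map_map N.measurable_equivDist (N.measurable_servingLink hb.measurable)]
  change (ProbabilityTheory.cond P₀ (N.cellularEvent Φb)).map (N.nearestDist Φb) = _
  rw [ProbabilityTheory.cond, Measure.restrict_congr_set (N.cellularEvent_ae_eq hb),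
    Measure.map_smul, ← Measure.restrict_map hmD measurableSet_Iio, N.map_nearestDist hb,
    N.measure_cellularEvent hb, restrict_withDensity measurableSet_Iio,
    Measure.restrict_restrict measurableSet_Iio, inter_comm, Ioi_inter_Iio,
    Measure.restrict_congr_set (Ioo_ae_eq_Ioc), ← withDensity_smul _ (by fun_prop), servingDistLaw]
  congr 1
  ext r
  rw [Pi.smul_apply, smul_eq_mul, servingPdf_eq,
    ← ENNReal.ofReal_inv_of_pos (by linarith), ← ENNReal.ofReal_mul]
  rw [inv_nonneg]
  linarith

lemma ae_servingLaw_pos : ∀ᵐ l ∂N.servingLaw Φb P₀, 0 < l.1 ∧ 0 < l.2 := by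
  have hm : MeasurableSet {l : ℝ × ℝ | 0 < l.1 ∧ 0 < l.2} :=
    (measurableSet_lt measurable_const measurable_fst).inter
      (measurableSet_lt measurable_const measurable_snd)
  rw [servingLaw, ae_map_iff (N.measurable_servingLink hb.measurable).aemeasurable hm]
  exact cond_absolutelyContinuous.ae_le (N.ae_servingLink_pos hb)

end Serving

end Network

/-! ### Fourier inversion for a nonnegative random variable. -/

section Inversion

lemma norm_cexp_neg_I_mul (w x : ℝ) : ‖Complex.exp (-(Complex.I * w * x))‖ = 1 := by
  rw [show -(Complex.I * w * x) = ((-(w * x) : ℝ) : ℂ) * Complex.I by push_cast; ring,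
    Complex.norm_exp_ofReal_mul_I]

lemma norm_inversionKernel_le {T : ℝ} (hT : 0 < T) (w : ℝ) :
    ‖inversionKernel T w‖ ≤ 1 / (2 * Real.pi * T) := by
  rcases eq_or_ne w 0 with rfl | hw
  · simp only [inversionKernel, Complex.ofReal_zero, mul_zero, div_zero, norm_zero]
    positivity
  · rw [inversionKernel, norm_div, div_le_iff₀ (by simp [hw])]
    have h1 : Complex.I * (w : ℂ) / T = Complex.I * ((w / T : ℝ) : ℂ) := by
      push_cast
      ring
    rw [h1]
    refine Real.norm_exp_I_mul_ofReal_sub_one_le.trans (le_of_eq ?_)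
    simp only [norm_mul, norm_div, Complex.norm_I, Complex.norm_real, Real.norm_eq_abs,
      abs_of_pos hT, abs_of_pos Real.pi_pos, Complex.norm_ofNat, mul_one]
    field_simp

lemma measurable_inversionKernel (T : ℝ) : Measurable (inversionKernel T) := by
  unfold inversionKernel
  fun_prop

variable {μ : Measure ℝ} [IsProbabilityMeasure μ]

/-- The integrand of a Fubini argument for characteristic functions. -/
lemma integrable_prod_cexp_mul {ν : Measure ℝ} [SFinite ν] {f : ℝ → ℂ} (hf : Integrable f ν) :
    Integrable (fun p : ℝ × ℝ => f p.1 * Complex.exp (-(Complex.I * p.1 * p.2))) (ν.prod μ) := by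
  have h := hf.mul_prod (integrable_const (1 : ℂ) (μ := μ))
  have hm : Measurable fun p : ℝ × ℝ => Complex.exp (-(Complex.I * p.1 * p.2)) := by fun_prop
  refine h.mono ((h.aestronglyMeasurable.mul hm.aestronglyMeasurable).congr
    (ae_of_all _ fun p => ?_)) (ae_of_all _ fun p => ?_)
  · simp
  · simp [norm_cexp_neg_I_mul]

/-- Averaging an oscillation over a long symmetric window isolates the frequency zero; this is what
detects atoms below. -/
lemma tendsto_average_cexp (y : ℝ) :
    Tendsto (fun W : ℝ => ((2 * W : ℝ) : ℂ)⁻¹ * ∫ w in (-W)..W, Complex.exp (Complex.I * y * w)) atTop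
      (𝓝 (if y = 0 then 1 else 0)) := by
  rcases eq_or_ne y 0 with rfl | hy
  · refine tendsto_const_nhds.congr' ?_
    filter_upwards [eventually_gt_atTop 0] with W hW
    have : (W : ℂ) ≠ 0 := by exact_mod_cast hW.ne'
    simp
    field_simp
    ring
  · rw [if_neg hy]
    have hc : Complex.I * (y : ℂ) ≠ 0 := by simp [hy]
    refine squeeze_zero_norm' (a := fun W : ℝ => |y|⁻¹ * W⁻¹) ?_ ?_
    · filter_upwards [eventually_gt_atTop 0] with W hW
      rw [integral_exp_mul_complex hc, norm_mul, norm_div, norm_inv]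
      have h1 : ∀ u : ℝ, ‖Complex.exp (Complex.I * y * u)‖ = 1 := fun u => by
        rw [show Complex.I * (y : ℂ) * u = ((y * u : ℝ) : ℂ) * Complex.I by push_cast; ring,
          Complex.norm_exp_ofReal_mul_I]
      have h2 : ‖Complex.exp (Complex.I * y * W) - Complex.exp (Complex.I * y * ((-W : ℝ) : ℂ))‖ ≤ 2 := by
        refine (norm_sub_le _ _).trans ?_
        rw [h1, h1]
        norm_num
      rw [norm_mul Complex.I, Complex.norm_I, Complex.norm_real, Complex.norm_real,
        Real.norm_eq_abs, Real.norm_eq_abs, one_mul]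
      rw [abs_of_pos (by positivity : (0 : ℝ) < 2 * W), div_eq_mul_inv]
      calc (2 * W)⁻¹ * (‖Complex.exp (Complex.I * y * W)
            - Complex.exp (Complex.I * y * ((-W : ℝ) : ℂ))‖ * |y|⁻¹)
          ≤ (2 * W)⁻¹ * (2 * |y|⁻¹) := by gcongr
        _ = |y|⁻¹ * W⁻¹ := by field_simp
    · simpa using tendsto_inv_atTop_zero.const_mul (|y|⁻¹)

/-- A probability measure with integrable characteristic function has no atoms. -/
lemma measureReal_singleton_eq_zero
    (hφ : Integrable fun w : ℝ => ∫ x, Complex.exp (-(Complex.I * w * x)) ∂μ) (a : ℝ) :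
    μ.real {a} = 0 := by
  -- The average of `exp (i a w) φ(w)` over `[-W, W]`, with `φ` the characteristic function of `hφ`,
  -- is computed in two ways. With the `x`-integral outside it tends to the mass of `a`.
  have h1 : Tendsto (fun W : ℝ => ∫ x, (((2 * W : ℝ) : ℂ)⁻¹ *
      ∫ w in (-W)..W, Complex.exp (Complex.I * ((a - x : ℝ) : ℂ) * w)) ∂μ) atTop
      (𝓝 (∫ x, (if a - x = 0 then 1 else 0) ∂μ)) := by
    refine tendsto_integral_filter_of_dominated_convergence (fun _ => 1) ?_ ?_
      (integrable_const _) (ae_of_all _ fun x => tendsto_average_cexp (a - x))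
    · refine Eventually.of_forall fun W => ?_
      refine AEStronglyMeasurable.const_mul ?_ _
      simp_rw [intervalIntegral.intervalIntegral_eq_integral_uIoc]
      refine AEStronglyMeasurable.const_smul ?_ _
      exact (StronglyMeasurable.integral_prod_left (μ := volume.restrict (uIoc (-W) W))
        (f := fun (w x : ℝ) => Complex.exp (Complex.I * ((a - x : ℝ) : ℂ) * w))
        (Measurable.stronglyMeasurable (by fun_prop))).aestronglyMeasurable
    · filter_upwards [eventually_gt_atTop 0] with W hW
      refine ae_of_all _ fun x => ?_
      have h := intervalIntegral.norm_integral_le_of_norm_le_const (a := -W) (b := W) (C := 1)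
        (f := fun w : ℝ => Complex.exp (Complex.I * ((a - x : ℝ) : ℂ) * w)) (fun w _ => by
          rw [show Complex.I * ((a - x : ℝ) : ℂ) * w = (((a - x) * w : ℝ) : ℂ) * Complex.I by
            push_cast; ring, Complex.norm_exp_ofReal_mul_I])
      rw [norm_mul, norm_inv, Complex.norm_real, Real.norm_eq_abs, abs_of_pos (by positivity)]
      rw [sub_neg_eq_add, one_mul, ← two_mul, abs_of_pos (by positivity : (0 : ℝ) < 2 * W)] at h
      calc _ ≤ (2 * W)⁻¹ * (2 * W) := by gcongr
        _ = 1 := by field_simp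
  -- With the `w`-integral outside it is at most the `L¹` norm of `φ` divided by `2W`, hence tends
  -- to zero.
  have h2 : Tendsto (fun W : ℝ => ∫ x, (((2 * W : ℝ) : ℂ)⁻¹ *
      ∫ w in (-W)..W, Complex.exp (Complex.I * ((a - x : ℝ) : ℂ) * w)) ∂μ) atTop (𝓝 0) := by
    set K := ∫ w : ℝ, ‖∫ x, Complex.exp (-(Complex.I * w * x)) ∂μ‖
    refine squeeze_zero_norm' (a := fun W : ℝ => (K / 2) * W⁻¹) ?_
      (by simpa using tendsto_inv_atTop_zero.const_mul (K / 2))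
    filter_upwards [eventually_gt_atTop 0] with W hW
    rw [integral_const_mul]
    have hle : -W ≤ W := by linarith
    have hs : ∫ x, (∫ w in (-W)..W, Complex.exp (Complex.I * ((a - x : ℝ) : ℂ) * w)) ∂μ
        = ∫ w in Ioc (-W) W, Complex.exp (Complex.I * a * w) *
          ∫ x, Complex.exp (-(Complex.I * w * x)) ∂μ := by
      simp_rw [intervalIntegral.integral_of_le hle, ← integral_const_mul]
      rw [integral_integral_swap]
      · refine integral_congr_ae (ae_of_all _ fun w => ?_)
        refine integral_congr_ae (ae_of_all _ fun x => ?_)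
        simp only
        rw [← Complex.exp_add]
        congr 1
        push_cast
        ring
      · have hi := integrable_prod_cexp_mul (μ := μ) (ν := volume.restrict (Ioc (-W) W))
          (f := fun w => Complex.exp (Complex.I * a * w))
          ((Continuous.integrableOn_Icc (by fun_prop)).mono_set Ioc_subset_Icc_self)
        refine hi.swap.congr (ae_of_all _ fun p => ?_)
        simp only [Function.comp, Prod.fst_swap, Prod.snd_swap, Function.uncurry]
        rw [← Complex.exp_add]
        congr 1
        push_cast
        ring
    rw [hs, norm_mul, norm_inv, Complex.norm_real, Real.norm_eq_abs, abs_of_pos (by positivity)]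
    have hK : ‖∫ w in Ioc (-W) W, Complex.exp (Complex.I * a * w) *
          ∫ x, Complex.exp (-(Complex.I * w * x)) ∂μ‖ ≤ K := by
      refine (norm_integral_le_integral_norm _).trans ?_
      have : ∀ w : ℝ, ‖Complex.exp (Complex.I * a * w) * ∫ x, Complex.exp (-(Complex.I * w * x)) ∂μ‖
          = ‖∫ x, Complex.exp (-(Complex.I * w * x)) ∂μ‖ := by
        intro w
        rw [norm_mul, show Complex.I * (a : ℂ) * w = ((a * w : ℝ) : ℂ) * Complex.I by
          push_cast; ring, Complex.norm_exp_ofReal_mul_I, one_mul]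
      simp_rw [this]
      exact setIntegral_le_integral hφ.norm (ae_of_all _ fun _ => norm_nonneg _)
    calc _ ≤ (2 * W)⁻¹ * K := by gcongr
      _ = K / 2 * W⁻¹ := by field_simp
  have h3 := tendsto_nhds_unique h1 h2
  have h4 : ∫ x, (if a - x = 0 then (1 : ℂ) else 0) ∂μ = (μ.real {a} : ℂ) := by
    have : (fun x => if a - x = 0 then (1 : ℂ) else 0) = ({a} : Set ℝ).indicator fun _ => 1 := by
      ext x
      simp [indicator_apply, sub_eq_zero, eq_comm]
    rw [this, integral_indicator_const _ (measurableSet_singleton a)]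
    simp
  rw [h4] at h3
  exact_mod_cast h3

/-- By Tonelli: a given point lies in the windows starting in an interval of length `a` (when `a >
0`), whatever the point. -/
lemma integrable_window (a : ℝ) : Integrable
    (fun p : ℝ × ℝ => (Ioo p.1 (p.1 + a)).indicator (fun _ => (1 : ℂ)) p.2) (volume.prod μ) := by
  have hS : MeasurableSet {p : ℝ × ℝ | p.1 < p.2 ∧ p.2 < p.1 + a} :=
    (measurableSet_lt measurable_fst measurable_snd).inter
      (measurableSet_lt measurable_snd (measurable_fst.add_const a))
  have he : (fun p : ℝ × ℝ => (Ioo p.1 (p.1 + a)).indicator (fun _ => (1 : ℂ)) p.2)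
      = {p : ℝ × ℝ | p.1 < p.2 ∧ p.2 < p.1 + a}.indicator fun _ => 1 := by
    ext p
    simp [indicator_apply]
  rw [he, integrable_indicator_iff hS]
  refine integrableOn_const ?_
  rw [Measure.prod_apply_symm hS]
  have : ∀ y : ℝ, (fun x => (x, y)) ⁻¹' {p : ℝ × ℝ | p.1 < p.2 ∧ p.2 < p.1 + a}
      = Ioo (y - a) y := by
    intro y
    ext x
    simp only [mem_preimage, mem_ofPred_eq, mem_Ioo]
    constructor <;> rintro ⟨h1, h2⟩ <;> constructor <;> linarith
  simp_rw [this]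
  simp

open FourierTransform in
/-- Inversion formula for a nonnegative random variable with integrable characteristic function. -/
theorem measureReal_Iio_eq_integral_inversionKernel (h0 : μ (Iio 0) = 0)
    (hφ : Integrable fun w : ℝ => ∫ x, Complex.exp (-(Complex.I * w * x)) ∂μ)
    {T : ℝ} (hT : 0 < T) :
    (μ.real (Iio (1 / T)) : ℂ) = ∫ w : ℝ, inversionKernel T w *
      ∫ x, Complex.exp (-(Complex.I * w * x)) ∂μ := by
  set a := 1 / T with ha_def
  have ha : 0 < a := by positivity
  set φ : ℝ → ℂ := fun w => ∫ x, Complex.exp (-(Complex.I * w * x)) ∂μ with hφ_def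
  -- `f v` is the mass of the window `(v, v + a)`. Its Fourier transform is, up to scaling, the
  -- inversion kernel times `φ`, and `f 0` is the desired probability. Pointwise inversion at `0`
  -- needs `f` integrable and continuous at `0` and its transform integrable.
  set f : ℝ → ℂ := fun v => ∫ x, (Ioo v (v + a)).indicator (fun _ => (1 : ℂ)) x ∂μ with hf_def
  have hkφ : Integrable fun w => inversionKernel T w * φ w :=
    hφ.bdd_mul (measurable_inversionKernel T).aestronglyMeasurable
      (ae_of_all _ (norm_inversionKernel_le hT))
  have hf : Integrable f := (integrable_window a).integral_prod_left
  -- At `ξ = 0` the identity fails, since division by zero gives `inversionKernel T 0 = 0`; one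
  -- point is negligible for the integral.
  have hfour : ∀ ξ : ℝ, ξ ≠ 0 → 𝓕 f ξ = (2 * Real.pi : ℝ) • (inversionKernel T (2 * Real.pi * ξ)
      * φ (2 * Real.pi * ξ)) := by
    intro ξ hξ
    rw [Real.fourier_real_eq_integral_exp_smul]
    simp only [hf_def, smul_eq_mul]
    simp_rw [← integral_const_mul]
    rw [integral_integral_swap]
    · have hin : ∀ x : ℝ, ∫ v : ℝ, Complex.exp (((-2 * Real.pi * v * ξ : ℝ) : ℂ) * Complex.I) *
          (Ioo v (v + a)).indicator (fun _ => (1 : ℂ)) x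
          = ((2 * Real.pi : ℝ) : ℂ) * inversionKernel T (2 * Real.pi * ξ) *
            Complex.exp (-(Complex.I * ((2 * Real.pi * ξ : ℝ) : ℂ) * x)) := by
        intro x
        have hc : -2 * Real.pi * ξ * Complex.I ≠ 0 := by simp [hξ, Real.pi_ne_zero]
        have e1 : ∀ v : ℝ, Complex.exp (((-2 * Real.pi * v * ξ : ℝ) : ℂ) * Complex.I) *
          (Ioo v (v + a)).indicator (fun _ => (1 : ℂ)) x = (Ioo (x - a) x).indicator
            (fun v : ℝ => Complex.exp ((-2 * Real.pi * ξ * Complex.I) * v)) v := by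
          intro v
          have : x ∈ Ioo v (v + a) ↔ v ∈ Ioo (x - a) x := by
            simp only [mem_Ioo]
            constructor <;> rintro ⟨h1, h2⟩ <;> constructor <;> linarith
          by_cases hv : x ∈ Ioo v (v + a)
          · rw [indicator_of_mem hv, indicator_of_mem (this.1 hv), mul_one]
            congr 1
            push_cast
            ring
          · rw [indicator_of_notMem hv, indicator_of_notMem (fun h => hv (this.2 h)), mul_zero]
        simp_rw [e1]
        rw [integral_indicator measurableSet_Ioo, ← integral_Ioc_eq_integral_Ioo,
          ← intervalIntegral.integral_of_le (by linarith), integral_exp_mul_complex hc,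
          inversionKernel]
        have hξ' : (ξ : ℂ) ≠ 0 := by exact_mod_cast hξ
        have hπ : (Real.pi : ℂ) ≠ 0 := by exact_mod_cast Real.pi_ne_zero
        have hT' : (T : ℂ) ≠ 0 := by exact_mod_cast hT.ne'
        have e2 : Complex.exp (-2 * Real.pi * ξ * Complex.I * x)
            = Complex.exp (-(Complex.I * ((2 * Real.pi * ξ : ℝ) : ℂ) * x)) := by
          congr 1
          push_cast
          ring
        have e3 : Complex.exp (-2 * Real.pi * ξ * Complex.I * ((x - a : ℝ) : ℂ))
            = Complex.exp (Complex.I * ((2 * Real.pi * ξ : ℝ) : ℂ) / T) *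
              Complex.exp (-(Complex.I * ((2 * Real.pi * ξ : ℝ) : ℂ) * x)) := by
          rw [← Complex.exp_add]
          congr 1
          rw [ha_def]
          push_cast
          field_simp
          ring
        rw [e2, e3]
        push_cast
        field_simp
        ring
      simp_rw [hin]
      rw [integral_const_mul]
      simp only [hφ_def, Complex.real_smul, mul_assoc]
    · have h := integrable_window (μ := μ) a
      refine h.mono ((Measurable.aestronglyMeasurable (by fun_prop)).mul h.aestronglyMeasurable)
        (ae_of_all _ fun p => ?_)
      simp only [Function.uncurry]
      rw [norm_mul, Complex.norm_exp_ofReal_mul_I, one_mul]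
  have h2π : (2 * Real.pi : ℝ) ≠ 0 := by positivity
  have hae : 𝓕 f =ᵐ[volume] fun ξ => (2 * Real.pi : ℝ) • (inversionKernel T (2 * Real.pi * ξ)
      * φ (2 * Real.pi * ξ)) := by
    filter_upwards [compl_mem_ae_iff.2 (measure_singleton (0 : ℝ))] with ξ hξ using hfour ξ hξ
  have hint : Integrable (𝓕 f) :=
    ((hkφ.comp_mul_left' h2π).smul (2 * Real.pi : ℝ)).congr hae.symm
  have hatom : ∀ b, μ {b} = 0 := fun b => by
    have := measureReal_singleton_eq_zero hφ b
    rwa [measureReal_eq_zero_iff] at this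
  -- Only points at the ends `0` and `a` could enter or leave the window under a small shift, and
  -- these are not atoms.
  have hcont : ContinuousAt f 0 := by
    refine continuousAt_of_dominated (bound := fun _ => 1) ?_ ?_ (integrable_const _) ?_
    · exact Eventually.of_forall fun v =>
        (measurable_const.indicator measurableSet_Ioo).aestronglyMeasurable
    · refine Eventually.of_forall fun v => ae_of_all _ fun x => ?_
      refine (norm_indicator_le_norm_self _ _).trans (by simp)
    · filter_upwards [compl_mem_ae_iff.2 (hatom 0), compl_mem_ae_iff.2 (hatom a)] with x hx0 hxa
      have hx0' : x ≠ 0 := hx0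
      have hxa' : x ≠ a := hxa
      refine ContinuousAt.congr (f := fun _ => (Ioo 0 a).indicator (fun _ => (1 : ℂ)) x)
        continuousAt_const ?_
      have hev : ∀ᶠ v : ℝ in 𝓝 0, (x ∈ Ioo 0 a ↔ x ∈ Ioo v (v + a)) := by
        have h1 : ∀ᶠ v : ℝ in 𝓝 0, (0 < x ↔ v < x) := by
          rcases lt_or_gt_of_ne hx0' with h | h
          · filter_upwards [lt_mem_nhds h] with v hv
            exact ⟨fun h' => absurd h' (by linarith), fun h' => absurd h' (by linarith)⟩
          · filter_upwards [gt_mem_nhds h] with v hv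
            exact ⟨fun _ => hv, fun _ => h⟩
        have h2 : ∀ᶠ v : ℝ in 𝓝 0, (x < a ↔ x < v + a) := by
          rcases lt_or_gt_of_ne hxa' with h | h
          · filter_upwards [lt_mem_nhds (show x - a < 0 by linarith)] with v hv
            exact ⟨fun _ => by linarith, fun _ => h⟩
          · filter_upwards [gt_mem_nhds (show 0 < x - a by linarith)] with v hv
            exact ⟨fun h' => absurd h' (by linarith), fun h' => absurd h' (by linarith)⟩
        filter_upwards [h1, h2] with v h1 h2
        rw [mem_Ioo, mem_Ioo, h1, h2]
      filter_upwards [hev] with v hv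
      simp [indicator_apply, hv]
  have hinv := hf.fourierInv_fourier_eq hint hcont
  rw [Real.fourierInv_eq'] at hinv
  simp only [inner_zero_right, mul_zero, Complex.ofReal_zero, zero_mul, Complex.exp_zero,
    one_smul] at hinv
  rw [integral_congr_ae hae, integral_smul,
    Measure.integral_comp_mul_left (fun w => inversionKernel T w * φ w) (2 * Real.pi),
    smul_smul, abs_inv, abs_of_pos (by positivity), mul_inv_cancel₀ h2π, one_smul] at hinv
  rw [hinv, hf_def]
  simp only [zero_add]
  rw [integral_indicator_const _ measurableSet_Ioo]
  simp only [Complex.real_smul, mul_one]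
  congr 1
  refine measureReal_congr ?_
  have hle : μ (Iic 0) = 0 := by
    rw [← Iio_union_right]
    exact measure_union_null h0 (hatom 0)
  filter_upwards [compl_mem_ae_iff.2 hle] with x hx
  have hx' : 0 < x := not_le.1 hx
  refine propext ?_
  change x < a ↔ 0 < x ∧ x < a
  simp [hx']

end Inversion

/-! ### Integration against the radial measure. -/

section Radial

variable {c : ℝ}

instance (c : ℝ) : SigmaFinite (radialMeasure c) :=
  SigmaFinite.withDensity_ofReal _

lemma integrable_radialMeasure_iff (hc : 0 < c) {H : ℝ → ℂ} :
    Integrable H (radialMeasure c) ↔ IntegrableOn (fun τ => H τ * τ) (Ioi 0) := by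
  rw [radialMeasure, integrable_withDensity_iff_integrable_smul' (by fun_prop)
    (ae_of_all _ fun x => ENNReal.ofReal_lt_top)]
  have hne : (2 * Real.pi * c : ℝ) ≠ 0 := by positivity
  rw [IntegrableOn, ← integrable_smul_iff hne (fun τ : ℝ => H τ * τ)]
  refine integrable_congr ?_
  filter_upwards [ae_restrict_mem measurableSet_Ioi] with τ hτ
  have : (0 : ℝ) < τ := hτ
  rw [ENNReal.toReal_ofReal (by positivity)]
  simp only [Pi.smul_apply, Complex.real_smul]
  push_cast
  ring

lemma integral_radialMeasure (hc : 0 < c) (H : ℝ → ℂ) :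
    ∫ τ, H τ ∂radialMeasure c = (2 * Real.pi * c : ℝ) * ∫ τ in Ioi (0 : ℝ), H τ * τ := by
  rw [radialMeasure, integral_withDensity_eq_integral_toReal_smul (by fun_prop)
    (ae_of_all _ fun x => ENNReal.ofReal_lt_top), ← integral_const_mul]
  refine setIntegral_congr_fun measurableSet_Ioi fun τ hτ => ?_
  have : (0 : ℝ) < τ := hτ
  rw [ENNReal.toReal_ofReal (by positivity), Complex.real_smul]
  push_cast
  ring

lemma integral_radialMeasure_of_eq_zero (hc : 0 < c) {H : ℝ → ℂ} {t : ℝ} (ht : 0 < t)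
    (h0 : ∀ τ, τ < t → H τ = 0) :
    ∫ τ, H τ ∂radialMeasure c = (2 * Real.pi * c : ℝ) * ∫ τ in Ioi t, H τ * τ := by
  rw [integral_radialMeasure hc, ← integral_Ici_eq_integral_Ioi (x := t)]
  congr 1
  refine setIntegral_eq_of_subset_of_forall_sdiff_eq_zero (μ := volume)
    (f := fun τ : ℝ => H τ * τ) measurableSet_Ioi
    (Ici_subset_Ioi.2 ht) fun x hx => ?_
  rw [h0 x (not_le.1 hx.2), zero_mul]

end Radial

/-! ### Interference of a marked Poisson process in polar form. -/

namespace Network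

variable (N : Network)

section Marked

variable {M : Type*} [MeasurableSpace M] (c : ℝ) (m : Measure M) [IsProbabilityMeasure m]

/-- Intensity of users in the plane with fading towards the typical base station and a mark of
law `m`. -/
noncomputable def markedIntensity : Measure ((Plane × ℝ) × M) :=
  (ENNReal.ofReal c • (volume : Measure Plane).prod N.fadingLaw).prod m

/-- Interference of a user whose mark contributes the factor `a`. -/
noncomputable def response (a : M → ℝ) (p : (Plane × ℝ) × M) : ℝ :=
  if N.cellRadius ≤ N.equivDist ‖p.1.1‖ p.1.2 then
    a p.2 * N.equivDist ‖p.1.1‖ p.1.2 ^ (-N.α) else 0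

/-- The response in terms of the equivalent distance. -/
noncomputable def radialResponse (a : M → ℝ) (p : ℝ × M) : ℝ :=
  if N.cellRadius ≤ p.1 then a p.2 * p.1 ^ (-N.α) else 0

instance : SigmaFinite (ENNReal.ofReal c • (volume : Measure Plane).prod N.fadingLaw) :=
  inferInstanceAs (SigmaFinite (Real.toNNReal c • (volume : Measure Plane).prod N.fadingLaw))

instance : SigmaFinite (N.markedIntensity c m) := by
  unfold markedIntensity
  infer_instance

omit [IsProbabilityMeasure m] in
lemma ae_markedIntensity {p : Plane × ℝ → Prop}
    (h : ∀ᵐ x ∂((volume : Measure Plane).prod N.fadingLaw), p x) :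
    ∀ᵐ x ∂N.markedIntensity c m, p x.1 :=
  Measure.quasiMeasurePreserving_fst.ae (Measure.ae_smul_measure h _)

/-- Location and fading enter the interference only through the equivalent distance, so this
projection turns integrals over the plane, fading and marks into radial ones. -/
lemma measurePreserving_markedIntensity : MeasurePreserving
    (Prod.map (fun p : Plane × ℝ => N.equivDist ‖p.1‖ p.2) id) (N.markedIntensity c m)
    (ENNReal.ofReal c • (radialMeasure N.fadingScale).prod m) where
  measurable := Measurable.prodMap (by fun_prop) measurable_id
  map_eq := by
    rw [markedIntensity, Measure.prod_smul_left, Measure.map_smul,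
      ← Measure.map_prod_map _ _ (by fun_prop) measurable_id, N.map_equivDist, Measure.map_id]

variable {a : M → ℝ}

lemma measurable_radialResponse (ha : Measurable a) : Measurable (N.radialResponse a) := by
  unfold radialResponse
  exact Measurable.ite (measurableSet_le measurable_const measurable_fst) (by fun_prop)
    measurable_const

omit [MeasurableSpace M] in
lemma response_eq (a : M → ℝ) : N.response a =
    N.radialResponse a ∘ Prod.map (fun p : Plane × ℝ => N.equivDist ‖p.1‖ p.2) id := rfl

lemma measurable_response (ha : Measurable a) : Measurable (N.response a) := by
  rw [response_eq]
  exact (N.measurable_radialResponse ha).comp (Measurable.prodMap (by fun_prop) measurable_id)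

omit [IsProbabilityMeasure m] in
lemma integrable_radialResponse (hi : Integrable a m) :
    Integrable (N.radialResponse a) ((radialMeasure N.fadingScale).prod m) := by
  have hα := N.two_lt_α
  have hrad : Integrable (fun τ : ℝ => if N.cellRadius ≤ τ then τ ^ (-N.α) else 0)
      (radialMeasure N.fadingScale) := by
    suffices h : Integrable (fun τ : ℝ => ((if N.cellRadius ≤ τ then τ ^ (-N.α) else 0 : ℝ) : ℂ))
        (radialMeasure N.fadingScale) by simpa using h.re
    rw [integrable_radialMeasure_iff N.fadingScale_pos]
    -- The radial density contributes one power of `τ`; `α > 2` makes `τ^(1-α)` integrable at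
    -- infinity, and the cutoff at `t > 0` removes the singularity at `0`.
    have h1 : IntegrableOn (fun τ : ℝ => ((τ ^ (1 - N.α) : ℝ) : ℂ)) (Ici N.cellRadius) := by
      rw [integrableOn_Ici_iff_integrableOn_Ioi]
      exact (integrableOn_Ioi_rpow_of_lt (by linarith) N.cellRadius_pos).ofReal
    rw [← integrable_indicator_iff measurableSet_Ici] at h1
    refine h1.integrableOn.congr_fun (fun τ hτ => ?_) measurableSet_Ioi
    have hτ' : (0 : ℝ) < τ := hτ
    by_cases h : N.cellRadius ≤ τ
    · rw [indicator_of_mem (by exact h), sub_eq_neg_add, Real.rpow_add hτ', Real.rpow_one]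
      simp [h]
    · rw [indicator_of_notMem (by exact h)]
      simp [h]
  refine (hrad.mul_prod hi).congr (ae_of_all _ fun p => ?_)
  simp only [radialResponse]
  split_ifs
  · ring
  · simp

lemma integrable_response (hi : Integrable a m) :
    Integrable (N.response a) (N.markedIntensity c m) := by
  have h := (N.integrable_radialResponse m hi).smul_measure (c := ENNReal.ofReal c)
    ENNReal.ofReal_ne_top
  rw [response_eq]
  exact (N.measurePreserving_markedIntensity c m).integrable_comp_of_integrable h

omit [MeasurableSpace M] in
lemma exp_radialResponse_sub_one (u τ : ℝ) (k : M) :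
    Complex.exp (Complex.I * ((-u * N.radialResponse a (τ, k) : ℝ) : ℂ)) - 1 =
      if N.cellRadius ≤ τ then
        Complex.exp (-(Complex.I * ((u * a k : ℝ) : ℂ) * ((τ ^ (-N.α) : ℝ) : ℂ))) - 1 else 0 := by
  unfold radialResponse
  split_ifs
  · congr 2
    push_cast
    ring
  · simp

/-- The radial integrand in the exponent of the characteristic function of the interference. -/
noncomputable def radialIntegrand (a : M → ℝ) (u τ : ℝ) : ℂ :=
  (1 - ∫ k, Complex.exp (-(Complex.I * ((u * a k : ℝ) : ℂ) * ((τ ^ (-N.α) : ℝ) : ℂ))) ∂m) * τ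

omit [IsProbabilityMeasure m] in
lemma integrable_exp_radialResponse (ha : Measurable a) (hi : Integrable a m) (u : ℝ) :
    Integrable (fun p => Complex.exp (Complex.I * ((-u * N.radialResponse a p : ℝ) : ℂ)) - 1)
      ((radialMeasure N.fadingScale).prod m) :=
  integrable_exp_I_mul_sub_one ((N.measurable_radialResponse ha).const_mul (-u))
    ((N.integrable_radialResponse m hi).const_mul (-u))

lemma integral_exp_radialResponse_mark (ha : Measurable a) (u τ : ℝ) :
    (∫ k, (Complex.exp (Complex.I * ((-u * N.radialResponse a (τ, k) : ℝ) : ℂ)) - 1) ∂m) * τ =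
      if N.cellRadius ≤ τ then -N.radialIntegrand m a u τ else 0 := by
  simp_rw [exp_radialResponse_sub_one]
  split_ifs
  · rw [integral_sub _ (integrable_const _), radialIntegrand]
    · simp
      ring
    · refine Integrable.of_bound (Measurable.aestronglyMeasurable (by fun_prop)) 1
        (ae_of_all _ fun k => ?_)
      rw [norm_cexp_neg_I_mul]
  · simp

lemma integrableOn_radialIntegrand (ha : Measurable a) (hi : Integrable a m) (u : ℝ) :
    IntegrableOn (N.radialIntegrand m a u) (Ioi N.cellRadius) := by
  have h := (N.integrable_exp_radialResponse m ha hi u).integral_prod_left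
  rw [integrable_radialMeasure_iff N.fadingScale_pos] at h
  have h2 := (h.mono_set (Ioi_subset_Ioi N.cellRadius_pos.le)).neg
  refine IntegrableOn.congr_fun h2 (fun τ hτ => ?_) measurableSet_Ioi
  simp only [Pi.neg_apply]
  rw [N.integral_exp_radialResponse_mark m ha, if_pos (le_of_lt hτ), neg_neg]

/-- The exponent of the characteristic functional in polar form: by Fubini the marks are averaged
first at each radius, and radii below `t` contribute nothing. -/
lemma integral_exp_response (hc : 0 ≤ c) (ha : Measurable a) (hi : Integrable a m) (u : ℝ) :
    ∫ p, (Complex.exp (Complex.I * ((-u * N.response a p : ℝ) : ℂ)) - 1) ∂N.markedIntensity c m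
      = -((2 * Real.pi * c * N.fadingScale : ℝ) : ℂ) *
        ∫ τ in Ioi N.cellRadius, N.radialIntegrand m a u τ := by
  have hI := N.integrable_exp_radialResponse m ha hi u
  have hmap := N.measurePreserving_markedIntensity c m
  have h1 : ∫ p, (Complex.exp (Complex.I * ((-u * N.response a p : ℝ) : ℂ)) - 1)
      ∂N.markedIntensity c m = ∫ p, (Complex.exp (Complex.I *
        ((-u * N.radialResponse a p : ℝ) : ℂ)) - 1)
        ∂(ENNReal.ofReal c • (radialMeasure N.fadingScale).prod m) := by
    rw [← hmap.map_eq, integral_map hmap.measurable.aemeasurable]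
    · rfl
    · rw [hmap.map_eq]
      exact (hI.smul_measure ENNReal.ofReal_ne_top).aestronglyMeasurable
  rw [h1, integral_smul_measure, ENNReal.toReal_ofReal hc, integral_prod _ hI,
    integral_radialMeasure_of_eq_zero N.fadingScale_pos N.cellRadius_pos]
  · rw [setIntegral_congr_fun (g := fun τ => -N.radialIntegrand m a u τ) measurableSet_Ioi
      fun τ hτ => ?_, integral_neg, Complex.real_smul]
    · push_cast
      ring
    · simp only
      rw [N.integral_exp_radialResponse_mark m ha, if_pos (le_of_lt hτ)]
  · intro τ hτ
    simp_rw [exp_radialResponse_sub_one]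
    simp [not_le.2 hτ]

end Marked

end Network

/-! ### Estimates for the decay of the characteristic function. -/

lemma integrable_exp_neg_mul_abs_rpow {p b : ℝ} (hp : 0 < p) (hb : 0 < b) :
    Integrable fun w : ℝ => Real.exp (-b * |w| ^ p) := by
  -- The integral of a nonintegrable function is `0` by convention, so its nonzero Gamma value
  -- proves integrability.
  refine .of_integral_ne_zero ?_
  rw [integral_comp_abs (f := fun w => Real.exp (-b * w ^ p)), integral_exp_neg_mul_rpow hp hb]
  have : 0 < Real.Gamma (1 / p + 1) := Real.Gamma_pos_of_pos (by positivity)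
  positivity

/-- Growth of the exponent of a stable-type characteristic function. -/
lemma le_integral_one_sub_cos_mul {α t b : ℝ} (hα : 0 < α) (ht : 0 < t) (hb : 0 ≤ b)
    (hi : IntegrableOn (fun τ : ℝ => (1 - Real.cos (b * τ ^ (-α))) * τ) (Ioi t)) :
    (1 - Real.cos (1 / 2)) * ((2 ^ (2 / α) - 1) / 2) * (b ^ (2 / α) - t ^ 2)
      ≤ ∫ τ in Ioi t, (1 - Real.cos (b * τ ^ (-α))) * τ := by
  have hnn : ∀ τ ∈ Ioi t, 0 ≤ (1 - Real.cos (b * τ ^ (-α))) * τ := fun τ hτ =>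
    mul_nonneg (by linarith [Real.cos_le_one (b * τ ^ (-α))]) (ht.trans hτ).le
  have hκ1 : 0 ≤ 1 - Real.cos (1 / 2) := by linarith [Real.cos_le_one (1 / 2)]
  have h2 : (1 : ℝ) ≤ 2 ^ (2 / α) := Real.one_le_rpow (by norm_num) (by positivity)
  have hκ2 : (0 : ℝ) ≤ (2 ^ (2 / α) - 1) / 2 := by linarith
  have hsq : ∀ x : ℝ, 0 ≤ x → (x ^ (1 / α)) ^ 2 = x ^ (2 / α) := by
    intro x hx
    rw [← Real.rpow_natCast, ← Real.rpow_mul hx]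
    congr 1
    push_cast
    ring
  -- If `b^(1/α) < t`, the term `-t²` makes the lower bound nonpositive and there is nothing to
  -- show.
  rcases lt_or_ge (b ^ (1 / α)) t with hbt | hbt
  · refine le_trans ?_ (setIntegral_nonneg measurableSet_Ioi hnn)
    refine mul_nonpos_of_nonneg_of_nonpos (mul_nonneg hκ1 hκ2) ?_
    rw [← hsq b hb]
    nlinarith [Real.rpow_nonneg hb (1 / α)]
  -- On `(x, y]` the phase `b τ^(-α)` lies in `[1/2, 1]`, so the integrand is at least `(1 - cos
  -- (1/2)) τ`; the integral of `τ` over this interval is `(2^(2/α) - 1) / 2 * b^(2/α)`.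
  · set x := b ^ (1 / α) with hx
    set y := (2 * b) ^ (1 / α) with hy
    have hx0 : 0 < x := ht.trans_le hbt
    have hb0 : 0 < b := by
      by_contra hc
      have : b = 0 := le_antisymm (not_lt.1 hc) hb
      rw [hx, this, Real.zero_rpow (by positivity)] at hx0
      exact lt_irrefl _ hx0
    have hxy : x ≤ y := Real.rpow_le_rpow hb (by linarith) (by positivity)
    have hsub : Ioc x y ⊆ Ioi t := fun τ hτ => hbt.trans_lt hτ.1
    have hbound : ∀ τ ∈ Ioc x y, (1 - Real.cos (1 / 2)) * τ ≤ (1 - Real.cos (b * τ ^ (-α))) * τ := by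
      intro τ hτ
      have hτ0 : 0 < τ := hx0.trans hτ.1
      have hpow : ∀ z : ℝ, 0 ≤ z → (z ^ (1 / α)) ^ α = z := fun z hz => by
        rw [← Real.rpow_mul hz, one_div_mul_cancel hα.ne', Real.rpow_one]
      have h3 : b ≤ τ ^ α := by
        rw [← hpow b hb]
        exact Real.rpow_le_rpow hx0.le hτ.1.le hα.le
      have h4 : τ ^ α ≤ 2 * b := by
        rw [← hpow (2 * b) (by positivity)]
        exact Real.rpow_le_rpow hτ0.le hτ.2 hα.le
      have hτα : 0 < τ ^ α := Real.rpow_pos_of_pos hτ0 _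
      have h5 : b * τ ^ (-α) ≤ 1 := by
        rw [Real.rpow_neg hτ0.le, ← div_eq_mul_inv, div_le_one hτα]
        exact h3
      have h6 : 1 / 2 ≤ b * τ ^ (-α) := by
        rw [Real.rpow_neg hτ0.le, ← div_eq_mul_inv, le_div_iff₀ hτα]
        linarith
      have h7 : Real.cos (b * τ ^ (-α)) ≤ Real.cos (1 / 2) :=
        Real.cos_le_cos_of_nonneg_of_le_pi (by norm_num)
          (h5.trans (by linarith [Real.pi_gt_three])) h6
      gcongr
    have hlin : ∫ τ in Ioc x y, (1 - Real.cos (1 / 2)) * τ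
        = (1 - Real.cos (1 / 2)) * ((y ^ 2 - x ^ 2) / 2) := by
      rw [integral_const_mul, ← intervalIntegral.integral_of_le hxy, integral_id]
    have hy2 : y ^ 2 = 2 ^ (2 / α) * b ^ (2 / α) := by
      rw [hy, hsq _ (by positivity), Real.mul_rpow (by norm_num) hb]
    have hx2 : x ^ 2 = b ^ (2 / α) := hsq b hb
    calc _ ≤ (1 - Real.cos (1 / 2)) * ((2 ^ (2 / α) - 1) / 2) * b ^ (2 / α) := by
          refine mul_le_mul_of_nonneg_left ?_ (mul_nonneg hκ1 hκ2)
          linarith [sq_nonneg t]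
      _ = ∫ τ in Ioc x y, (1 - Real.cos (1 / 2)) * τ := by
          rw [hlin, hy2, hx2]
          ring
      _ ≤ ∫ τ in Ioc x y, (1 - Real.cos (b * τ ^ (-α))) * τ :=
          setIntegral_mono_on ((Continuous.integrableOn_Icc (by fun_prop)).mono_set
            Ioc_subset_Icc_self) (hi.mono_set hsub) measurableSet_Ioc hbound
      _ ≤ _ := setIntegral_mono_set hi ((ae_restrict_iff' measurableSet_Ioi).2 (ae_of_all _ hnn))
          hsub.eventuallyLE

lemma integral_uniformOn_bool (F : Bool → ℂ) :
    ∫ b, F b ∂uniformOn (univ : Set Bool) = (F true + F false) / 2 := by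
  have h : ∀ b : Bool, (uniformOn (univ : Set Bool)).real {b} = 1 / 2 := by
    intro b
    rw [Measure.real, uniformOn_univ, Measure.count_singleton]
    simp
  rw [integral_fintype (Integrable.of_finite)]
  simp only [Fintype.univ_bool, Finset.sum_insert, Finset.mem_singleton, Bool.true_eq_false,
    not_false_eq_true, Finset.sum_singleton, h, Complex.real_smul]
  push_cast
  ring

/-! ### Signal, interference and exponents of the uplink model. -/

namespace Network

variable (N : Network)

/-- Received power of a cellular user at equivalent distance `r`. -/
noncomputable def signalAt (r : ℝ) : ℝ := N.P0 * N.A ^ (1 - N.ε) * r ^ (N.α * (N.ε - 1))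

lemma signalAt_pos {r : ℝ} (hr : 0 < r) : 0 < N.signalAt r :=
  mul_pos (mul_pos N.P0_pos (Real.rpow_pos_of_pos N.A_pos _)) (Real.rpow_pos_of_pos hr _)

lemma measurable_signalAt : Measurable N.signalAt := by
  unfold signalAt
  fun_prop

lemma signal_eq {l : ℝ × ℝ} (h1 : 0 < l.1) (h2 : 0 < l.2) :
    N.signal l = N.signalAt (N.equivDist l.1 l.2) := by
  have hd := equivDist_pos (N := N) h1 h2
  rw [signal, uplinkTxPower_eq h1 h2, gain_eq h1 h2, signalAt,
    show N.α * (N.ε - 1) = N.α * N.ε + -N.α by ring, Real.rpow_add hd,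
    show 1 - N.ε = -N.ε + 1 by ring, Real.rpow_add N.A_pos, Real.rpow_one]
  ring

/-- The mark factor of a cellular interferer. -/
noncomputable def cuFactor (l : ℝ × ℝ) : ℝ :=
  N.P0 * N.A ^ (1 - N.ε) * N.equivDist l.1 l.2 ^ (N.α * N.ε)

/-- The mark factor of a D2D user. -/
noncomputable def d2dFactor (b : Bool) : ℝ := if b = true then N.Pd * N.A else 0

lemma measurable_cuFactor : Measurable N.cuFactor := by
  unfold cuFactor
  exact (N.measurable_equivDist.pow_const _).const_mul _

lemma cuInterference_eq {p : (Plane × ℝ) × (ℝ × ℝ)} (h1 : 0 < ‖p.1.1‖ ∧ 0 < p.1.2)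
    (h2 : 0 < p.2.1 ∧ 0 < p.2.2) : N.cuInterference p = N.response N.cuFactor p := by
  rw [cuInterference, response, uplinkTxPower_eq h2.1 h2.2, gain_eq h1.1 h1.2, cuFactor,
    show 1 - N.ε = -N.ε + 1 by ring, Real.rpow_add N.A_pos, Real.rpow_one]
  simp only [downlinkPower_le_β_iff h1.1 h1.2]
  congr 1
  ring

lemma d2dInterference_eq {p : (Plane × ℝ) × Bool} (h1 : 0 < ‖p.1.1‖ ∧ 0 < p.1.2) :
    N.d2dInterference p = N.response N.d2dFactor p := by
  rw [d2dInterference, response, gain_eq h1.1 h1.2, d2dFactor]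
  simp only [downlinkPower_le_β_iff h1.1 h1.2]
  rcases p.2 with _ | _
  · simp
  · simp only [true_and, if_true, mul_assoc]

lemma response_cuFactor_nonneg {p : (Plane × ℝ) × (ℝ × ℝ)} (h1 : 0 < ‖p.1.1‖ ∧ 0 < p.1.2)
    (h2 : 0 < p.2.1 ∧ 0 < p.2.2) : 0 ≤ N.response N.cuFactor p := by
  have ha := equivDist_pos (N := N) h1.1 h1.2
  have hb := equivDist_pos (N := N) h2.1 h2.2
  have := N.P0_pos
  have := N.A_pos
  unfold response cuFactor
  split_ifs <;> positivity

lemma response_d2dFactor_nonneg {p : (Plane × ℝ) × Bool} (h1 : 0 < ‖p.1.1‖ ∧ 0 < p.1.2) :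
    0 ≤ N.response N.d2dFactor p := by
  have ha := equivDist_pos (N := N) h1.1 h1.2
  have := N.Pd_pos
  have := N.A_pos
  unfold response d2dFactor
  split_ifs <;> positivity

lemma servingPdf_nonneg {r : ℝ} (hr : 0 ≤ r) : 0 ≤ N.servingPdf r := by
  have h1 := N.exp_neg_rate_lt_one
  have h2 := N.nearestRate_pos
  rw [servingPdf_eq]
  have : 0 < 1 - Real.exp (-N.nearestRate * N.cellRadius ^ 2) := by linarith
  positivity

lemma continuous_servingPdf : Continuous N.servingPdf := by
  have : N.servingPdf = fun r => (1 - Real.exp (-N.nearestRate * N.cellRadius ^ 2))⁻¹ *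
      (2 * N.nearestRate * r * Real.exp (-N.nearestRate * r ^ 2)) := funext N.servingPdf_eq
  rw [this]
  fun_prop

lemma integral_servingDistLaw (F : ℝ → ℂ) : ∫ r, F r ∂N.servingDistLaw =
    ∫ r in (0 : ℝ)..N.cellRadius, F r * (N.servingPdf r : ℂ) := by
  rw [servingDistLaw, integral_withDensity_eq_integral_toReal_smul
    (N.continuous_servingPdf.measurable.ennreal_ofReal) (ae_of_all _ fun x => ENNReal.ofReal_lt_top),
    intervalIntegral.integral_of_le N.cellRadius_pos.le]
  refine setIntegral_congr_fun measurableSet_Ioc fun r hr => ?_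
  rw [ENNReal.toReal_ofReal (N.servingPdf_nonneg hr.1.le), Complex.real_smul, mul_comm]

lemma ae_servingDistLaw_mem : ∀ᵐ r ∂N.servingDistLaw, r ∈ Ioc 0 N.cellRadius :=
  (withDensity_absolutelyContinuous _ _).ae_le (ae_restrict_mem measurableSet_Ioc)

section Exponents

variable {ν : Measure (ℝ × ℝ)} [IsProbabilityMeasure ν]
  (hν : ν.map (fun l => N.equivDist l.1 l.2) = N.servingDistLaw)
include hν

omit [IsProbabilityMeasure ν] in
lemma ae_equivDist_mem : ∀ᵐ l ∂ν, N.equivDist l.1 l.2 ∈ Ioc 0 N.cellRadius := by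
  have h := N.ae_servingDistLaw_mem
  rw [← hν] at h
  exact ae_of_ae_map N.measurable_equivDist.aemeasurable h

lemma integrable_cuFactor : Integrable N.cuFactor ν := by
  refine Integrable.of_bound N.measurable_cuFactor.aestronglyMeasurable
    (N.P0 * N.A ^ (1 - N.ε) * N.cellRadius ^ (N.α * N.ε)) ?_
  have := N.P0_pos
  have := N.A_pos
  have := N.α_pos
  have := N.ε_pos
  filter_upwards [N.ae_equivDist_mem hν] with l hl
  have h0 : 0 < N.equivDist l.1 l.2 := hl.1
  have hle := Real.rpow_le_rpow h0.le hl.2 (by positivity : 0 ≤ N.α * N.ε)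
  rw [Real.norm_eq_abs, cuFactor, abs_of_nonneg (by positivity)]
  gcongr

omit [IsProbabilityMeasure ν] in
-- The serving distance only rescales the frequency to `w / signalAt r₀`; the common factor `P0
-- A^(1-ε)` of signal and interference cancels.
lemma cuIntegrand_eq {r₀ : ℝ} (hr : 0 < r₀) (w τ : ℝ) :
    N.cuIntegrand r₀ w τ = N.radialIntegrand ν N.cuFactor (w / N.signalAt r₀) τ := by
  rw [cuIntegrand, radialIntegrand, ← N.integral_servingDistLaw, ← hν,
    integral_map N.measurable_equivDist.aemeasurable
      (Measurable.aestronglyMeasurable (by fun_prop))]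
  congr 3
  ext l
  congr 3
  have h1 : (N.P0 : ℂ) ≠ 0 := by exact_mod_cast N.P0_pos.ne'
  have h2 : ((N.A ^ (1 - N.ε) : ℝ) : ℂ) ≠ 0 := by
    exact_mod_cast (Real.rpow_pos_of_pos N.A_pos _).ne'
  have h3 : ((r₀ ^ (N.α * (N.ε - 1)) : ℝ) : ℂ) ≠ 0 := by
    exact_mod_cast (Real.rpow_pos_of_pos hr _).ne'
  rw [signalAt, cuFactor]
  push_cast
  field_simp

end Exponents

lemma radialIntegrand_d2dFactor (u τ : ℝ) :
    N.radialIntegrand (uniformOn univ) N.d2dFactor u τ =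
      (1 - Complex.exp (-(Complex.I * ((u * (N.Pd * N.A) : ℝ) : ℂ) * ((τ ^ (-N.α) : ℝ) : ℂ)))) * τ
        / 2 := by
  rw [radialIntegrand, integral_uniformOn_bool]
  simp only [d2dFactor, if_true, Bool.false_eq_true, if_false, mul_zero, Complex.ofReal_zero,
    zero_mul, neg_zero, Complex.exp_zero]
  ring

/-- The fair coin halves the contribution, which is why the D2D exponent carries `π` where the
cellular one carries `2π`. -/
lemma d2dIntegrand_eq {r₀ : ℝ} (hr : 0 < r₀) (w τ : ℝ) :
    N.d2dIntegrand r₀ w τ =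
      2 * N.radialIntegrand (uniformOn univ) N.d2dFactor (w / N.signalAt r₀) τ := by
  rw [radialIntegrand_d2dFactor, d2dIntegrand, mul_div_cancel₀ _ (two_ne_zero)]
  congr 4
  have h1 : (N.P0 : ℂ) ≠ 0 := by exact_mod_cast N.P0_pos.ne'
  have h2 : ((N.A ^ N.ε : ℝ) : ℂ) ≠ 0 := by
    exact_mod_cast (Real.rpow_pos_of_pos N.A_pos _).ne'
  have h3 : ((r₀ ^ (N.α * (N.ε - 1)) : ℝ) : ℂ) ≠ 0 := by
    exact_mod_cast (Real.rpow_pos_of_pos hr _).ne'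
  have h4 : (N.A : ℂ) ≠ 0 := by exact_mod_cast N.A_pos.ne'
  rw [signalAt, Real.rpow_sub N.A_pos, Real.rpow_one]
  push_cast
  field_simp

lemma integrable_d2dFactor : Integrable N.d2dFactor (uniformOn univ) := Integrable.of_finite

/-- The D2D factor of the characteristic function decays like a stretched exponential. -/
lemma norm_exp_integral_d2dFactor_le {c : ℝ} (hc : 0 ≤ c) (u : ℝ) :
    ‖Complex.exp (-(c : ℂ) * ∫ τ in Ioi N.cellRadius,
      N.radialIntegrand (uniformOn univ) N.d2dFactor u τ)‖ ≤
      Real.exp (-(c / 2 * ((1 - Real.cos (1 / 2)) * ((2 ^ (2 / N.α) - 1) / 2) *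
        ((|u| * (N.Pd * N.A)) ^ (2 / N.α) - N.cellRadius ^ 2)))) := by
  have hI := N.integrableOn_radialIntegrand (uniformOn univ) (Measurable.of_discrete)
    N.integrable_d2dFactor u
  have hre : ∀ τ : ℝ, (N.radialIntegrand (uniformOn univ) N.d2dFactor u τ).re =
      2⁻¹ * ((1 - Real.cos (|u| * (N.Pd * N.A) * τ ^ (-N.α))) * τ) := by
    intro τ
    have e1 : -(Complex.I * ((u * (N.Pd * N.A) : ℝ) : ℂ) * ((τ ^ (-N.α) : ℝ) : ℂ))
        = ((-(u * (N.Pd * N.A) * τ ^ (-N.α)) : ℝ) : ℂ) * Complex.I := by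
      push_cast
      ring
    -- The cosine is even, so the growth estimate, stated for a nonnegative coefficient, covers both
    -- signs of `u`.
    have e2 : Real.cos (|u| * (N.Pd * N.A) * τ ^ (-N.α))
        = Real.cos (u * (N.Pd * N.A) * τ ^ (-N.α)) := by
      rcases abs_choice u with h | h <;> rw [h]
      rw [← Real.cos_neg]
      congr 1
      ring
    rw [radialIntegrand_d2dFactor, e1, e2,
      show ∀ z : ℂ, (1 - z) * (τ : ℂ) / 2 = ((2⁻¹ * τ : ℝ) : ℂ) * (1 - z) by
        intro z; push_cast; ring,
      Complex.re_ofReal_mul, Complex.sub_re, Complex.exp_ofReal_mul_I_re, Real.cos_neg]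
    simp
    ring
  have hIre : IntegrableOn (fun τ : ℝ =>
      (1 - Real.cos (|u| * (N.Pd * N.A) * τ ^ (-N.α))) * τ) (Ioi N.cellRadius) := by
    have h : IntegrableOn (fun τ : ℝ => 2⁻¹ *
        ((1 - Real.cos (|u| * (N.Pd * N.A) * τ ^ (-N.α))) * τ)) (Ioi N.cellRadius) := by
      have := hI.re
      simp only [RCLike.re_eq_complex_re, hre] at this
      exact this
    refine (h.const_mul 2).congr (ae_of_all _ fun τ => ?_)
    ring
  have hint : (∫ τ in Ioi N.cellRadius,
      N.radialIntegrand (uniformOn univ) N.d2dFactor u τ).re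
      = 2⁻¹ * ∫ τ in Ioi N.cellRadius,
        (1 - Real.cos (|u| * (N.Pd * N.A) * τ ^ (-N.α))) * τ := by
    have := integral_re hI
    simp only [RCLike.re_eq_complex_re] at this
    rw [← this, ← integral_const_mul]
    simp_rw [hre]
  have hlow := le_integral_one_sub_cos_mul N.α_pos N.cellRadius_pos
    (mul_nonneg (abs_nonneg u) (mul_pos N.Pd_pos N.A_pos).le) hIre
  rw [Complex.norm_exp, Real.exp_le_exp, ← Complex.ofReal_neg, Complex.re_ofReal_mul, hint]
  have := mul_le_mul_of_nonneg_left hlow (by positivity : 0 ≤ c / 2)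
  linarith

end Network

/-- By independence the conditional law of `Y` given `X` is the constant kernel `P.map Y`, so `X`
can be frozen. -/
lemma condExp_comp_ae_eq_of_indepFun {Ω β : Type*} [MeasurableSpace Ω] [mβ : MeasurableSpace β]
    {P : Measure Ω} [IsProbabilityMeasure P] {X : Ω → β} {Y : Ω → ℝ} (hX : Measurable X)
    (hY : Measurable Y) (hXY : IndepFun X Y P) {F : β × ℝ → ℂ} (hF : StronglyMeasurable F)
    (hi : Integrable (fun ω => F (X ω, Y ω)) P) :
    P[fun ω => F (X ω, Y ω) | mβ.comap X] =ᵐ[P] fun ω => ∫ y, F (X ω, y) ∂P.map Y := by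
  have := Measure.isProbabilityMeasure_map (μ := P) hY.aemeasurable
  have h := condDistrib_ae_eq_of_measure_eq_compProd (μ := P) X hY.aemeasurable
    (κ := Kernel.const β (P.map Y)) (by
      rw [Measure.compProd_const]
      exact (indepFun_iff_map_prod_eq_prod_map_map hX.aemeasurable hY.aemeasurable).1 hXY)
  have h2 := ae_of_ae_map hX.aemeasurable h
  filter_upwards [condExp_prod_ae_eq_integral_condDistrib hX hY.aemeasurable hF hi, h2] with ω h3 h4
  rw [h3, h4, Kernel.const_apply]

/-! ### Characteristic function of the disturbance, conditioning and coverage. -/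

namespace Network

variable (N : Network)

section ShotNoise

variable {Ω M : Type*} [MeasurableSpace Ω] [MeasurableSpace M] {P : Measure Ω}
  [IsProbabilityMeasure P] {c : ℝ} {m : Measure M} [IsProbabilityMeasure m]
  {X : ℕ → Ω → (Plane × ℝ) × M} (hX : IsPoissonProcess X (N.markedIntensity c m) P)
  {a : M → ℝ} (ha : Measurable a) (hi : Integrable a m) {f : (Plane × ℝ) × M → ℝ}
  (hf : ∀ᵐ p ∂N.markedIntensity c m, f p = N.response a p ∧ 0 ≤ N.response a p)
include hX ha hi hf

omit [IsProbabilityMeasure P] in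
lemma ae_tsum_ofReal_ne_top : ∀ᵐ ω ∂P, ∑' n, ENNReal.ofReal (f (X n ω)) ≠ ∞ := by
  have hm := N.measurable_response ha
  have h1 : ∫⁻ ω, ∑' n, ENNReal.ofReal (N.response a (X n ω)) ∂P ≠ ∞ := by
    rw [hX.lintegral_tsum_eq (g := fun p => ENNReal.ofReal (N.response a p)) hm.ennreal_ofReal]
    exact (N.integrable_response c m hi).lintegral_lt_top.ne
  have h2 := ae_lt_top (.tsum fun n => (hm.comp (hX.measurable n)).ennreal_ofReal) h1
  filter_upwards [h2, hX.ae_forall_of_ae hf] with ω h3 h4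
  simp_rw [fun n => (h4 n).1]
  exact h3.ne

omit [IsProbabilityMeasure P] ha hi in
lemma ae_toReal_tsum_ofReal :
    ∀ᵐ ω ∂P, (∑' n, ENNReal.ofReal (f (X n ω))).toReal = ∑' n, N.response a (X n ω) := by
  filter_upwards [hX.ae_forall_of_ae hf] with ω h
  rw [ENNReal.tsum_toReal_eq fun n => ENNReal.ofReal_ne_top]
  congr 1
  ext n
  rw [(h n).1, ENNReal.toReal_ofReal (h n).2]

/-- The characteristic functional applied to `-u` times the response; the extended nonnegative sum
of the model agrees almost surely with the real one. -/
lemma integral_exp_shotNoise (hc : 0 ≤ c) (u : ℝ) :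
    ∫ ω, Complex.exp (-(Complex.I * u * (((∑' n, ENNReal.ofReal (f (X n ω))).toReal : ℝ) : ℂ))) ∂P
      = Complex.exp (-((2 * Real.pi * c * N.fadingScale : ℝ) : ℂ) *
        ∫ τ in Ioi N.cellRadius, N.radialIntegrand m a u τ) := by
  rw [← N.integral_exp_response c m hc ha hi u]
  rw [← hX.integral_exp_tsum (g := fun p => -u * N.response a p)
    ((N.measurable_response ha).const_mul _) ((N.integrable_response c m hi).const_mul _)]
  refine integral_congr_ae ?_
  filter_upwards [N.ae_toReal_tsum_ofReal hX hf] with ω h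
  rw [h, tsum_mul_left]
  congr 1
  push_cast
  ring

end ShotNoise

lemma measurable_cuInterference : Measurable N.cuInterference := by
  unfold cuInterference uplinkTxPower gain
  refine Measurable.ite (measurableSet_le ?_ measurable_const) (by fun_prop) measurable_const
  exact N.measurable_downlinkPower (by fun_prop) (by fun_prop)

lemma measurable_d2dInterference : Measurable N.d2dInterference := by
  unfold d2dInterference gain
  have hm : MeasurableSet {p : (Plane × ℝ) × Bool | N.downlinkPower ‖p.1.1‖ p.1.2 ≤ N.β} :=
    measurableSet_le (N.measurable_downlinkPower (by fun_prop) (by fun_prop)) measurable_const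
  exact Measurable.ite ((measurable_snd (measurableSet_singleton true)).inter hm) (by fun_prop)
    measurable_const

lemma condCharFun_eq_mul {ν : Measure (ℝ × ℝ)}
    (hν : ν.map (fun l => N.equivDist l.1 l.2) = N.servingDistLaw) (q : ℝ) {r₀ : ℝ} (hr : 0 < r₀)
    (w : ℝ) : N.condCharFun q r₀ w =
    Complex.exp (-((2 * Real.pi * N.lamB * N.fadingScale : ℝ) : ℂ) *
        ∫ τ in Ioi N.cellRadius, N.radialIntegrand ν N.cuFactor (w / N.signalAt r₀) τ) *
      Complex.exp (-((2 * Real.pi * ((1 - q) * N.lamU) * N.fadingScale : ℝ) : ℂ) *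
        ∫ τ in Ioi N.cellRadius, N.radialIntegrand (uniformOn univ) N.d2dFactor
          (w / N.signalAt r₀) τ) *
      Complex.exp (-(Complex.I * ((w / N.signalAt r₀ : ℝ) : ℂ) * N.η)) := by
  rw [condCharFun]
  simp_rw [N.cuIntegrand_eq hν hr, N.d2dIntegrand_eq hr]
  rw [integral_const_mul]
  congr 1
  · congr 1
    congr 1
    simp only [fadingScale]
    push_cast
    ring
  · congr 2
    rw [signalAt, Real.rpow_sub N.A_pos, Real.rpow_sub N.A_pos, Real.rpow_one]
    have h1 : (N.P0 : ℂ) ≠ 0 := by exact_mod_cast N.P0_pos.ne'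
    have h2 : ((N.A ^ N.ε : ℝ) : ℂ) ≠ 0 := by
      exact_mod_cast (Real.rpow_pos_of_pos N.A_pos _).ne'
    have h3 : ((r₀ ^ (N.α * (N.ε - 1)) : ℝ) : ℂ) ≠ 0 := by
      exact_mod_cast (Real.rpow_pos_of_pos hr _).ne'
    have h4 : (N.A : ℂ) ≠ 0 := by exact_mod_cast N.A_pos.ne'
    push_cast
    field_simp

section Uplink

variable {Ω : Type*} [MeasurableSpace Ω] {P : Measure Ω} [IsProbabilityMeasure P]
  {ν : Measure (ℝ × ℝ)} [IsProbabilityMeasure ν] {q : ℝ} {L₀ : Ω → ℝ × ℝ}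
  {Φc : ℕ → Ω → (Plane × ℝ) × (ℝ × ℝ)} {Φd : ℕ → Ω → (Plane × ℝ) × Bool}

/-- Interference and noise as a function of the configurations of interferers. -/
noncomputable def totalInterference
    (x : (ℕ → (Plane × ℝ) × (ℝ × ℝ)) × (ℕ → (Plane × ℝ) × Bool)) : ℝ≥0∞ :=
  (∑' n, ENNReal.ofReal (N.cuInterference (x.1 n))) +
    (∑' n, ENNReal.ofReal (N.d2dInterference (x.2 n))) + ENNReal.ofReal N.η

lemma measurable_tsum_cuInterference : Measurable
    fun x : ℕ → (Plane × ℝ) × (ℝ × ℝ) => ∑' n, ENNReal.ofReal (N.cuInterference (x n)) :=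
  .tsum fun n => (N.measurable_cuInterference.comp (measurable_pi_apply n)).ennreal_ofReal

lemma measurable_tsum_d2dInterference : Measurable
    fun x : ℕ → (Plane × ℝ) × Bool => ∑' n, ENNReal.ofReal (N.d2dInterference (x n)) :=
  .tsum fun n => (N.measurable_d2dInterference.comp (measurable_pi_apply n)).ennreal_ofReal

lemma measurable_totalInterference : Measurable N.totalInterference :=
  ((N.measurable_tsum_cuInterference.comp measurable_fst).add
    (N.measurable_tsum_d2dInterference.comp measurable_snd)).add_const _

/-- Interference and noise at the typical base station. -/
noncomputable def disturbance (Φc : ℕ → Ω → (Plane × ℝ) × (ℝ × ℝ))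
    (Φd : ℕ → Ω → (Plane × ℝ) × Bool) (ω : Ω) : ℝ :=
  (N.totalInterference (fun n => Φc n ω, fun n => Φd n ω)).toReal

omit [MeasurableSpace Ω] in
lemma disturbance_nonneg (ω : Ω) : 0 ≤ N.disturbance Φc Φd ω := ENNReal.toReal_nonneg

omit [IsProbabilityMeasure ν] in
lemma ae_cuInterference_eq (hpos : ∀ᵐ l ∂ν, 0 < l.1 ∧ 0 < l.2) :
    ∀ᵐ p ∂N.markedIntensity N.lamB ν,
      N.cuInterference p = N.response N.cuFactor p ∧ 0 ≤ N.response N.cuFactor p := by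
  have h2 : ∀ᵐ p ∂N.markedIntensity N.lamB ν, 0 < p.2.1 ∧ 0 < p.2.2 :=
    Measure.quasiMeasurePreserving_snd.ae hpos
  filter_upwards [N.ae_markedIntensity N.lamB ν N.ae_pos_pos, h2] with p h1 h2
  exact ⟨N.cuInterference_eq h1 h2, N.response_cuFactor_nonneg h1 h2⟩

lemma ae_d2dInterference_eq (c : ℝ) : ∀ᵐ p ∂N.markedIntensity c (uniformOn (univ : Set Bool)),
      N.d2dInterference p = N.response N.d2dFactor p ∧ 0 ≤ N.response N.d2dFactor p := by
  filter_upwards [N.ae_markedIntensity c _ N.ae_pos_pos] with p h1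
  exact ⟨N.d2dInterference_eq h1, N.response_d2dFactor_nonneg h1⟩

variable (hup : N.IsUplinkModel ν q L₀ Φc Φd P)
  (hν : ν.map (fun l => N.equivDist l.1 l.2) = N.servingDistLaw)
  (hpos : ∀ᵐ l ∂ν, 0 < l.1 ∧ 0 < l.2)
include hup

omit [IsProbabilityMeasure P] [IsProbabilityMeasure ν] in
lemma measurable_disturbance : Measurable (N.disturbance Φc Φd) :=
  (N.measurable_totalInterference.comp ((measurable_pi_lambda _ hup.poisson_cu.measurable).prodMk
    (measurable_pi_lambda _ hup.poisson_d2d.measurable))).ennreal_toReal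

omit [IsProbabilityMeasure P] [IsProbabilityMeasure ν] in
lemma measurable_servingEquivDist : Measurable (N.servingEquivDist L₀) :=
  N.measurable_equivDist.comp hup.measurable_link

omit [IsProbabilityMeasure P] [IsProbabilityMeasure ν] in
lemma indepFun_servingEquivDist_disturbance :
    IndepFun (N.servingEquivDist L₀) (N.disturbance Φc Φd) P :=
  hup.indep_link.comp N.measurable_equivDist N.measurable_totalInterference.ennreal_toReal

include hpos hν

omit [IsProbabilityMeasure P] in
lemma ae_tsum_ne_top : ∀ᵐ ω ∂P, ∑' n, ENNReal.ofReal (N.cuInterference (Φc n ω)) ≠ ∞ ∧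
    ∑' n, ENNReal.ofReal (N.d2dInterference (Φd n ω)) ≠ ∞ :=
  (N.ae_tsum_ofReal_ne_top (m := ν) (c := N.lamB) hup.poisson_cu N.measurable_cuFactor
    (N.integrable_cuFactor hν) (N.ae_cuInterference_eq hpos)).and
  (N.ae_tsum_ofReal_ne_top (m := uniformOn univ) (c := (1 - q) * N.lamU) hup.poisson_d2d
    (.of_discrete) N.integrable_d2dFactor (N.ae_d2dInterference_eq _))

lemma integral_exp_disturbance (hq : q < 1) (u : ℝ) :
    ∫ ω, Complex.exp (-(Complex.I * u * (N.disturbance Φc Φd ω : ℂ))) ∂P =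
      Complex.exp (-((2 * Real.pi * N.lamB * N.fadingScale : ℝ) : ℂ) *
        ∫ τ in Ioi N.cellRadius, N.radialIntegrand ν N.cuFactor u τ) *
      Complex.exp (-((2 * Real.pi * ((1 - q) * N.lamU) * N.fadingScale : ℝ) : ℂ) *
        ∫ τ in Ioi N.cellRadius, N.radialIntegrand (uniformOn univ) N.d2dFactor u τ) *
      Complex.exp (-(Complex.I * u * N.η)) := by
  rw [← N.integral_exp_shotNoise (m := ν) (c := N.lamB) hup.poisson_cu N.measurable_cuFactor
    (N.integrable_cuFactor hν) (N.ae_cuInterference_eq hpos) N.lamB_pos.le,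
    ← N.integral_exp_shotNoise (m := uniformOn univ) (c := (1 - q) * N.lamU) hup.poisson_d2d
    (.of_discrete) N.integrable_d2dFactor (N.ae_d2dInterference_eq _)
    (mul_nonneg (by linarith) N.lamU_pos.le)]
  have hmc := measurable_pi_lambda (fun ω n => Φc n ω) hup.poisson_cu.measurable
  have hmd := measurable_pi_lambda (fun ω n => Φd n ω) hup.poisson_d2d.measurable
  have hcexp : Measurable fun x : ℝ≥0∞ => Complex.exp (-(Complex.I * u * (x.toReal : ℂ))) := by
    fun_prop
  have hind := hup.indep_cu_d2d.comp (hcexp.comp N.measurable_tsum_cuInterference)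
    (hcexp.comp N.measurable_tsum_d2dInterference)
  have hmul := hind.integral_fun_mul_eq_mul_integral
    ((hcexp.comp N.measurable_tsum_cuInterference).comp hmc).aestronglyMeasurable
    ((hcexp.comp N.measurable_tsum_d2dInterference).comp hmd).aestronglyMeasurable
  simp only [Function.comp] at hmul
  rw [← hmul, ← integral_mul_const]
  refine integral_congr_ae ?_
  filter_upwards [N.ae_tsum_ne_top hup hν hpos] with ω h
  rw [disturbance, totalInterference, ENNReal.toReal_add (ENNReal.add_ne_top.2 h)
    ENNReal.ofReal_ne_top, ENNReal.toReal_add h.1 h.2, ENNReal.toReal_ofReal N.η_nonneg,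
    ← Complex.exp_add, ← Complex.exp_add]
  congr 1
  push_cast
  ring

/-- At each fixed `r₀` the closed form is an honest characteristic function, as the inversion
theorem requires. -/
lemma condCharFun_eq_integral (hq : q < 1) {r₀ : ℝ} (hr : 0 < r₀) (w : ℝ) :
    N.condCharFun q r₀ w =
      ∫ z, Complex.exp (-(Complex.I * w * z))
        ∂P.map (fun ω => N.disturbance Φc Φd ω / N.signalAt r₀) := by
  have hm := N.measurable_disturbance hup
  rw [N.condCharFun_eq_mul hν q hr w,
    ← N.integral_exp_disturbance hup hν hpos hq,
    integral_map (hm.div_const _).aemeasurable (Measurable.aestronglyMeasurable (by fun_prop))]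
  congr 1
  ext ω
  congr 1
  push_cast
  ring

/-- The cellular factor is a characteristic function and the noise factor a phase, so neither
exceeds one in modulus; all decay comes from the D2D factor, whose transmit power is deterministic.
-/
lemma norm_condCharFun_le (hq : q < 1) {r₀ : ℝ} (hr : 0 < r₀) (w : ℝ) :
    ‖N.condCharFun q r₀ w‖ ≤ Real.exp (-((2 * Real.pi * ((1 - q) * N.lamU) * N.fadingScale) / 2 *
      ((1 - Real.cos (1 / 2)) * ((2 ^ (2 / N.α) - 1) / 2) *
        ((|w / N.signalAt r₀| * (N.Pd * N.A)) ^ (2 / N.α) - N.cellRadius ^ 2)))) := by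
  have hc : 0 ≤ 2 * Real.pi * ((1 - q) * N.lamU) * N.fadingScale := by
    have := N.lamU_pos
    have := N.fadingScale_pos
    have : 0 < 1 - q := by linarith
    positivity
  rw [N.condCharFun_eq_mul hν q hr w, norm_mul, norm_mul]
  have h1 : ‖Complex.exp (-((2 * Real.pi * N.lamB * N.fadingScale : ℝ) : ℂ) *
      ∫ τ in Ioi N.cellRadius, N.radialIntegrand ν N.cuFactor (w / N.signalAt r₀) τ)‖ ≤ 1 := by
    rw [← N.integral_exp_shotNoise (m := ν) (c := N.lamB) hup.poisson_cu N.measurable_cuFactor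
      (N.integrable_cuFactor hν) (N.ae_cuInterference_eq hpos) N.lamB_pos.le]
    refine (norm_integral_le_of_norm_le_const (C := 1) (ae_of_all _ fun ω => ?_)).trans (by simp)
    rw [norm_cexp_neg_I_mul]
  rw [norm_cexp_neg_I_mul, mul_one]
  refine (mul_le_of_le_one_left (norm_nonneg _) h1).trans ?_
  exact N.norm_exp_integral_d2dFactor_le hc (w / N.signalAt r₀)

lemma integrable_condCharFun (hq : q < 1) {r₀ : ℝ} (hr : 0 < r₀) :
    Integrable (N.condCharFun q r₀) := by
  have hm := N.measurable_disturbance hup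
  have hS := N.signalAt_pos hr
  have hmeas : AEStronglyMeasurable (N.condCharFun q r₀) := by
    have h : N.condCharFun q r₀ = fun w : ℝ => ∫ z, Complex.exp (-(Complex.I * w * z))
        ∂P.map (fun ω => N.disturbance Φc Φd ω / N.signalAt r₀) :=
      funext (N.condCharFun_eq_integral hup hν hpos hq hr)
    have := Measure.isProbabilityMeasure_map (μ := P) (hm.div_const (N.signalAt r₀)).aemeasurable
    rw [h]
    exact (StronglyMeasurable.integral_prod_right
      (f := fun w z : ℝ => Complex.exp (-(Complex.I * w * z)))
      (Measurable.stronglyMeasurable (by fun_prop))).aestronglyMeasurable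
  set c := (2 * Real.pi * ((1 - q) * N.lamU) * N.fadingScale) / 2 *
    ((1 - Real.cos (1 / 2)) * ((2 ^ (2 / N.α) - 1) / 2)) with hc_def
  have hα := N.α_pos
  have hPA : 0 < N.Pd * N.A := mul_pos N.Pd_pos N.A_pos
  have hc : 0 < c := by
    have := N.lamU_pos
    have := N.fadingScale_pos
    have : 0 < 1 - q := by linarith
    have : Real.cos (1 / 2) < 1 := by
      have h := Real.cos_lt_cos_of_nonneg_of_le_pi le_rfl
        (by linarith only [Real.pi_gt_three] : (1 / 2 : ℝ) ≤ Real.pi) (by norm_num)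
      rwa [Real.cos_zero] at h
    have : 0 < 1 - Real.cos (1 / 2) := by linarith
    have : (1 : ℝ) < 2 ^ (2 / N.α) := Real.one_lt_rpow (by norm_num) (by positivity)
    have : (0 : ℝ) < (2 ^ (2 / N.α) - 1) / 2 := by linarith
    positivity
  set b := c * (N.Pd * N.A / N.signalAt r₀) ^ (2 / N.α) with hb_def
  have hb : 0 < b := mul_pos hc (Real.rpow_pos_of_pos (div_pos hPA hS) _)
  refine ((integrable_exp_neg_mul_abs_rpow (p := 2 / N.α) (by positivity) hb).const_mul
    (Real.exp (c * N.cellRadius ^ 2))).mono' hmeas (ae_of_all _ fun w => ?_)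
  refine (N.norm_condCharFun_le hup hν hpos hq hr w).trans (le_of_eq ?_)
  rw [← Real.exp_add]
  congr 1
  have : |w / N.signalAt r₀| * (N.Pd * N.A) = |w| * (N.Pd * N.A / N.signalAt r₀) := by
    rw [abs_div, abs_of_pos hS]
    ring
  rw [this, Real.mul_rpow (abs_nonneg w) (by positivity), hb_def, hc_def]
  ring

omit hν in
omit [IsProbabilityMeasure P] [IsProbabilityMeasure ν] in
lemma ae_link_pos : ∀ᵐ ω ∂P, 0 < (L₀ ω).1 ∧ 0 < (L₀ ω).2 := by
  rw [← hup.law_link] at hpos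
  exact ae_of_ae_map hup.measurable_link.aemeasurable hpos

omit hpos in
omit [IsProbabilityMeasure P] [IsProbabilityMeasure ν] in
lemma map_servingEquivDist : P.map (N.servingEquivDist L₀) = N.servingDistLaw := by
  rw [← hν, ← hup.law_link, Measure.map_map N.measurable_equivDist hup.measurable_link]
  rfl

omit [IsProbabilityMeasure P] in
lemma ae_sinr_inv : ∀ᵐ ω ∂P, (N.sinr L₀ Φc Φd ω)⁻¹ ≠ ∞ ∧ (N.sinr L₀ Φc Φd ω)⁻¹.toReal =
    N.disturbance Φc Φd ω / N.signalAt (N.servingEquivDist L₀ ω) := by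
  filter_upwards [N.ae_tsum_ne_top hup hν hpos, N.ae_link_pos hup hpos] with ω h1 h2
  have hS : 0 < N.signal (L₀ ω) := by
    rw [N.signal_eq h2.1 h2.2]
    exact N.signalAt_pos (equivDist_pos h2.1 h2.2)
  have hI : N.totalInterference (fun n => Φc n ω, fun n => Φd n ω) ≠ ∞ :=
    ENNReal.add_ne_top.2 ⟨ENNReal.add_ne_top.2 h1, ENNReal.ofReal_ne_top⟩
  have hsinr : (N.sinr L₀ Φc Φd ω)⁻¹ = N.totalInterference (fun n => Φc n ω, fun n => Φd n ω) /
      ENNReal.ofReal (N.signal (L₀ ω)) := by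
    rw [sinr, ENNReal.inv_div (Or.inr ENNReal.ofReal_ne_top)
      (Or.inr (ENNReal.ofReal_pos.2 hS).ne')]
    rfl
  rw [hsinr]
  refine ⟨ENNReal.div_ne_top hI (ENNReal.ofReal_pos.2 hS).ne', ?_⟩
  rw [ENNReal.toReal_div, ENNReal.toReal_ofReal hS.le, N.signal_eq h2.1 h2.2]
  rfl

theorem condExp_exp_inv_sinr (hq : q < 1) (w : ℝ) :
    P[fun ω => Complex.exp (-(Complex.I * w * (((N.sinr L₀ Φc Φd ω)⁻¹).toReal : ℂ))) |
        MeasurableSpace.comap (N.servingEquivDist L₀) inferInstance]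
      =ᵐ[P] fun ω => N.condCharFun q (N.servingEquivDist L₀ ω) w := by
  have hmZ := N.measurable_disturbance hup
  have hmR := N.measurable_servingEquivDist hup
  have hmS := N.measurable_signalAt
  set F : ℝ × ℝ → ℂ := fun p => Complex.exp (-(Complex.I * w * ((p.2 / N.signalAt p.1 : ℝ) : ℂ)))
  have hF : Measurable F := by fun_prop
  have h1 : (fun ω => Complex.exp (-(Complex.I * w * (((N.sinr L₀ Φc Φd ω)⁻¹).toReal : ℂ))))
      =ᵐ[P] fun ω => F (N.servingEquivDist L₀ ω, N.disturbance Φc Φd ω) := by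
    filter_upwards [N.ae_sinr_inv hup hν hpos] with ω h
    rw [h.2]
  have hint : Integrable (fun ω => F (N.servingEquivDist L₀ ω, N.disturbance Φc Φd ω)) P := by
    refine Integrable.of_bound (hF.comp (hmR.prodMk hmZ)).aestronglyMeasurable 1
      (ae_of_all _ fun ω => ?_)
    rw [norm_cexp_neg_I_mul]
  refine (condExp_congr_ae h1).trans ?_
  have h2 := condExp_comp_ae_eq_of_indepFun hmR hmZ
    (N.indepFun_servingEquivDist_disturbance hup) hF.stronglyMeasurable hint
  filter_upwards [h2, N.ae_link_pos hup hpos] with ω h3 h4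
  have hr : 0 < N.servingEquivDist L₀ ω := equivDist_pos h4.1 h4.2
  rw [h3, N.condCharFun_eq_integral hup hν hpos hq hr,
    integral_map hmZ.aemeasurable (Measurable.aestronglyMeasurable (by fun_prop)),
    integral_map (hmZ.div_const _).aemeasurable (Measurable.aestronglyMeasurable (by fun_prop))]

/-- The conditional coverage probability given the equivalent serving distance. -/
lemma integral_inversionKernel_condCharFun (hq : q < 1) {T : ℝ} (hT : 0 < T) {r₀ : ℝ}
    (hr : 0 < r₀) : ∫ w : ℝ, inversionKernel T w * N.condCharFun q r₀ w =
      (P.real {ω | N.disturbance Φc Φd ω / N.signalAt r₀ < 1 / T} : ℂ) := by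
  have hm := (N.measurable_disturbance hup).div_const (N.signalAt r₀)
  have := Measure.isProbabilityMeasure_map (μ := P) hm.aemeasurable
  have hφ := N.integrable_condCharFun hup hν hpos hq hr
  have heq : N.condCharFun q r₀ = fun w : ℝ => ∫ z, Complex.exp (-(Complex.I * w * z))
      ∂P.map (fun ω => N.disturbance Φc Φd ω / N.signalAt r₀) :=
    funext (N.condCharFun_eq_integral hup hν hpos hq hr)
  rw [heq] at hφ
  have h0 : P.map (fun ω => N.disturbance Φc Φd ω / N.signalAt r₀) (Iio 0) = 0 := by
    rw [Measure.map_apply hm measurableSet_Iio]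
    convert measure_empty (μ := P)
    refine eq_empty_of_forall_notMem fun ω hω => ?_
    exact absurd (div_nonneg (N.disturbance_nonneg ω) (N.signalAt_pos hr).le) (not_le.2 hω)
  have h := measureReal_Iio_eq_integral_inversionKernel h0 hφ hT
  rw [heq, ← h, map_measureReal_apply hm measurableSet_Iio]
  rfl

theorem measureReal_lt_sinr (hq : q < 1) {T : ℝ} (hT : 0 < T) :
    IntervalIntegrable (fun r : ℝ => (∫ w : ℝ, inversionKernel T w * N.condCharFun q r w)
      * (N.servingPdf r : ℂ)) volume 0 N.cellRadius ∧
    ((P.real {ω | ENNReal.ofReal T < N.sinr L₀ Φc Φd ω} : ℝ) : ℂ) =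
      ∫ r in (0 : ℝ)..N.cellRadius,
        (∫ w : ℝ, inversionKernel T w * N.condCharFun q r w) * (N.servingPdf r : ℂ) := by
  have hmZ := N.measurable_disturbance hup
  have hmR := N.measurable_servingEquivDist hup
  have hmS := N.measurable_signalAt
  -- Coverage as an event on the pair of serving distance and disturbance, whose joint law is a
  -- product; the sections of `B` carry the conditional coverage probabilities `g r`.
  set B : Set (ℝ × ℝ) := {p | p.2 / N.signalAt p.1 < 1 / T} with hB_def
  have hB : MeasurableSet B :=
    measurableSet_lt (measurable_snd.div (hmS.comp measurable_fst)) measurable_const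
  have hprob := Measure.isProbabilityMeasure_map (μ := P) hmZ.aemeasurable
  have hprobR := Measure.isProbabilityMeasure_map (μ := P) hmR.aemeasurable
  set g : ℝ → ℝ := fun r => (P.map (N.disturbance Φc Φd)).real (Prod.mk r ⁻¹' B) with hg_def
  have hgm : Measurable g := (measurable_measure_prodMk_left hB).ennreal_toReal
  have hg : ∀ r, 0 < r → ∫ w : ℝ, inversionKernel T w * N.condCharFun q r w = (g r : ℂ) := by
    intro r hr
    rw [N.integral_inversionKernel_condCharFun hup hν hpos hq hT hr, hg_def]
    simp only
    rw [map_measureReal_apply hmZ (measurable_prodMk_left hB)]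
    rfl
  have hset : P.real {ω | ENNReal.ofReal T < N.sinr L₀ Φc Φd ω}
      = P.real ((fun ω => (N.servingEquivDist L₀ ω, N.disturbance Φc Φd ω)) ⁻¹' B) := by
    refine measureReal_congr ?_
    filter_upwards [N.ae_sinr_inv hup hν hpos] with ω h
    refine propext ?_
    change ENNReal.ofReal T < N.sinr L₀ Φc Φd ω ↔
      N.disturbance Φc Φd ω / N.signalAt (N.servingEquivDist L₀ ω) < 1 / T
    -- Inverting among extended nonnegative numbers also covers vanishing disturbance, where the
    -- SINR is infinite.
    rw [← h.2, ← ENNReal.inv_lt_inv, ← ENNReal.ofReal_inv_of_pos hT, one_div,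
      ENNReal.lt_ofReal_iff_toReal_lt h.1]
  have hmain : P.real {ω | ENNReal.ofReal T < N.sinr L₀ Φc Φd ω} = ∫ r, g r ∂N.servingDistLaw := by
    rw [hset, ← map_measureReal_apply (hmR.prodMk hmZ) hB,
      (indepFun_iff_map_prod_eq_prod_map_map hmR.aemeasurable hmZ.aemeasurable).1
        (N.indepFun_servingEquivDist_disturbance hup), ← N.map_servingEquivDist hup hν,
      measureReal_def, Measure.prod_apply hB,
      integral_eq_lintegral_of_nonneg_ae (ae_of_all _ fun r => measureReal_nonneg)
        hgm.aestronglyMeasurable]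
    congr 1
    refine lintegral_congr fun r => ?_
    exact (ofReal_measureReal (measure_ne_top _ _)).symm
  have hcongr : ∀ r ∈ Ioc 0 N.cellRadius, (∫ w : ℝ, inversionKernel T w * N.condCharFun q r w)
      * (N.servingPdf r : ℂ) = (g r : ℂ) * (N.servingPdf r : ℂ) := fun r hr => by
    rw [hg r hr.1]
  constructor
  · rw [intervalIntegrable_iff_integrableOn_Ioc_of_le N.cellRadius_pos.le]
    have hpdf : IntegrableOn (fun r => (N.servingPdf r : ℂ)) (Ioc 0 N.cellRadius) :=
      ((Complex.continuous_ofReal.comp N.continuous_servingPdf).integrableOn_Icc).mono_set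
        Ioc_subset_Icc_self
    have h : IntegrableOn (fun r => (g r : ℂ) * (N.servingPdf r : ℂ)) (Ioc 0 N.cellRadius) := by
      refine hpdf.bdd_mul (c := 1) (Measurable.aestronglyMeasurable (by fun_prop))
        (ae_of_all _ fun r => ?_)
      rw [Complex.norm_real, Real.norm_eq_abs, abs_of_nonneg measureReal_nonneg]
      exact measureReal_le_one
    exact h.congr_fun (fun r hr => (hcongr r hr).symm) measurableSet_Ioc
  · rw [hmain, ← integral_complex_ofReal, N.integral_servingDistLaw,
      intervalIntegral.integral_of_le N.cellRadius_pos.le,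
      intervalIntegral.integral_of_le N.cellRadius_pos.le]
    exact setIntegral_congr_fun measurableSet_Ioc fun r hr => (hcongr r hr).symm

end Uplink

end Network

theorem lemma4 (N : Network)
    {Ω₀ Ω : Type*} [MeasurableSpace Ω₀] [MeasurableSpace Ω]
    (P₀ : Measure Ω₀) [IsProbabilityMeasure P₀] (P : Measure Ω) [IsProbabilityMeasure P]
    (Φb : ℕ → Ω₀ → Plane × ℝ) (hb : IsPoissonProcess Φb N.bsIntensity P₀)
    (L₀ : Ω → ℝ × ℝ) (Φc : ℕ → Ω → (Plane × ℝ) × (ℝ × ℝ)) (Φd : ℕ → Ω → (Plane × ℝ) × Bool)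
    (hup : N.IsUplinkModel (N.servingLaw Φb P₀) (N.cellularProb Φb P₀) L₀ Φc Φd P)
    (T : ℝ) (hT : 0 < T) :
    -- the equivalent serving distance has density `servingPdf` on `(0, t]`
    P.map (N.servingEquivDist L₀) =
      (volume.restrict (Ioc 0 N.cellRadius)).withDensity
        (fun r => ENNReal.ofReal (N.servingPdf r)) ∧
    -- the integrals in the exponents converge
    (∀ r₀ ∈ Ioc 0 N.cellRadius, ∀ w : ℝ,
      IntegrableOn (N.cuIntegrand r₀ w) (Ioi N.cellRadius) ∧
      IntegrableOn (N.d2dIntegrand r₀ w) (Ioi N.cellRadius)) ∧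
    -- `condCharFun` is the conditional characteristic function of `1 / SINR`
    (∀ᵐ ω ∂P, (N.sinr L₀ Φc Φd ω)⁻¹ ≠ ∞) ∧
    (∀ w : ℝ,
      P[fun ω => Complex.exp (-(Complex.I * w * (((N.sinr L₀ Φc Φd ω)⁻¹).toReal : ℂ))) |
          MeasurableSpace.comap (N.servingEquivDist L₀) inferInstance]
        =ᵐ[P] fun ω => N.condCharFun (N.cellularProb Φb P₀) (N.servingEquivDist L₀ ω) w) ∧
    -- the coverage probability
    (∀ r₀ ∈ Ioc 0 N.cellRadius,
      Integrable (fun w : ℝ => inversionKernel T w *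
        N.condCharFun (N.cellularProb Φb P₀) r₀ w)) ∧
    IntervalIntegrable (fun r : ℝ =>
      (∫ w : ℝ, inversionKernel T w * N.condCharFun (N.cellularProb Φb P₀) r w)
        * (N.servingPdf r : ℂ)) volume 0 N.cellRadius ∧
    ((P.real {ω | ENNReal.ofReal T < N.sinr L₀ Φc Φd ω} : ℝ) : ℂ) =
      ∫ r in (0 : ℝ)..N.cellRadius,
        (∫ w : ℝ, inversionKernel T w * N.condCharFun (N.cellularProb Φb P₀) r w)
          * (N.servingPdf r : ℂ) := by
  have hν := N.map_servingLaw hb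
  have hpos := N.ae_servingLaw_pos hb
  have hq := N.cellularProb_lt_one hb
  -- The serving law has total mass one because it is the law of the random link `L₀`.
  have hprob : IsProbabilityMeasure (N.servingLaw Φb P₀) :=
    hup.law_link ▸ Measure.isProbabilityMeasure_map hup.measurable_link.aemeasurable
  refine ⟨N.map_servingEquivDist hup hν, fun r₀ hr w => ⟨?_, ?_⟩, ?_,
    N.condExp_exp_inv_sinr hup hν hpos hq, fun r₀ hr => ?_, N.measureReal_lt_sinr hup hν hpos hq hT⟩
  · have h : N.cuIntegrand r₀ w = _ := funext (N.cuIntegrand_eq hν hr.1 w)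
    rw [h]
    exact N.integrableOn_radialIntegrand _ N.measurable_cuFactor (N.integrable_cuFactor hν) _
  · have h : N.d2dIntegrand r₀ w = _ := funext (N.d2dIntegrand_eq hr.1 w)
    rw [h]
    exact (N.integrableOn_radialIntegrand _ .of_discrete N.integrable_d2dFactor _).const_mul 2
  · filter_upwards [N.ae_sinr_inv hup hν hpos] with ω h using h.1
  · exact (N.integrable_condCharFun hup hν hpos hq hr.1).bdd_mul
      (measurable_inversionKernel T).aestronglyMeasurable
      (ae_of_all _ (norm_inversionKernel_le hT))
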